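/- **Setting.** A *structured DTD* $D=(Ele,Rg,rt)$ has a finite set $Ele$ of element types, a root type $rt\in Ele$ and, for each $A\in Ele$, a production $Rg(A)$ of one of the forms $\mathsf{str}$, $\epsilon$, $B_1,\dots,B_n$, $B_1+\dots+B_n$, $B^*$, with $n\ge 1$ and distinct $B_i\in Ele$. The types occurring in $Rg(A)$ are the subelement types of $A$, and $\le_D$ is the reflexive transitive closure of this relation. $D$ is assumed non-recursive (the subelement graph is acyclic), with every element type reachable from $rt$. Documents are finite rooted unordered trees with nodes labeled by element types or $\mathsf{str}$ and with string values on the $\mathsf{str}$-nodes. Such a tree is in $I_D(A)$ if its root is labeled $A$, the children of each $B$-labeled node can be listed so that their labels form a word of $Rg(B)$, and $\mathsf{str}$-nodes are leaves; it conforms to $D$ if it is in $I_D(rt)$. $\equiv$ is isomorphism of such trees. Atomic updates are $\mathrm{insert}(n,t')$ (add $t'$ below $n$), $\mathrm{delete}(n)$ and $\mathrm{replace}(n,t')$ (delete, respectively replace by $t'$, the subtree at $n$), and $\mathrm{replace}(n,s)$ (change the text value of $n$ to $s$); they are valid on $t$ if $n$ is a node of $t$ and the nodes of $t'$ are not in $t$.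 $[\![\cdot]\!](t)$ is the result on $t$. On a tree $t$, $\mathrm{insert}(n,t')$ matches $(A,\mathrm{insert}(B))$ if $n$ is labeled $A$ and $t'\in I_D(B)$; and, when the parent of $n$ is labeled $A$, $\mathrm{delete}(n)$ matches $(A,\mathrm{delete}(B))$ if $n$ is labeled $B$; $\mathrm{replace}(n,t')$ matches $(A,\mathrm{replace}(B,B'))$ if $n$ is labeled $B$, $t'\in I_D(B')$ and $B\ne B'$; $\mathrm{replace}(n,s)$ matches $(A,\mathrm{replace}(\mathsf{str},\mathsf{str}))$ if $n$ is labeled $\mathsf{str}$. The set $\mathrm{valid}(D)$ of valid update access types consists of $(A,\mathrm{insert}(B))$ and $(A,\mathrm{delete}(B))$ for $Rg(A)=B^*$; $(A,\mathrm{replace}(\mathsf{str},\mathsf{str}))$ for $Rg(A)=\mathsf{str}$; and $(A,\mathrm{replace}(B_i,B_j))$, $i\neq j$, for $Rg(A)=B_1+\dots+B_n$. A *policy* over $D$ is a pair $P=(\mathcal A_P,\mathcal F_P)$ of disjoint subsets of $\mathrm{valid}(D)$ (allowed and forbidden types). It need not be *total*, that is, satisfy $\mathcal A_P\cup\mathcal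 F_P=\mathrm{valid}(D)$. $Q$ *extends* $P$ if $\mathcal A_P\subseteq\mathcal A_Q$ and $\mathcal F_P\subseteq\mathcal F_Q$. A sequence $op_1;\dots;op_k$ is allowed on $t$ if each $op_i$ is valid on, and matches a member of $\mathcal A_P$ on, the tree to which it is applied. $P$ is *consistent* if there are no tree $t$ conforming to $D$, sequence $op_1;\dots;op_k$ allowed on $t$, and valid update $op_0$ on $t$ matching a member of $\mathcal F_P$, such that $[\![op_0]\!](t)\not\equiv t$ and $[\![op_1;\dots;op_k]\!](t)\equiv[\![op_0]\!](t)$. (The condition $[\![op_0]\!](t)\not\equiv t$ only sets aside the replacement of a text value by itself.) $P$ is *quasiconsistent* if it has a consistent total extension. For $S\subseteq\mathrm{valid}(D)$ let $\mathcal G_A^+(S)$ be the transitive closure of the graph with edges $(B,B')$ for $(A,\mathrm{replace}(B,B'))\in S$. Let $T(S)$ be the union of $S$ with the set of those members of $\mathrm{valid}(D)$ that are of one of the following forms: * $(C,op)$, where $B\le_D C$ for some $A$, $B$ with $Rg(A)=B^*$ and $(A,\mathrm{insert}(B)),(A,\mathrm{delete}(B))\in S$; * $(C,op)$, where $B_i\le_D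 C$ for some $A$, $B_i$ with $Rg(A)=B_1+\dots+B_n$ and $(B_i,B_i)\in\mathcal G_A^+(S)$; * $(A,\mathrm{replace}(B_i,B_k))$, where $Rg(A)=B_1+\dots+B_n$ and $(B_i,B_k)\in\mathcal G_A^+(S)$. **Theorem.** Let $P$ be a policy over $D$, total or not. The following are equivalent: 1. $P$ is quasiconsistent; 2. $P$ is consistent; 3. $T(\mathcal A_P)\cap\mathcal F_P=\emptyset$. In that case $(T(\mathcal A_P),\ \mathrm{valid}(D)\setminus T(\mathcal A_P))$ is a policy over $D$ that is a consistent total extension of $P$. -/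

import Mathlib

namespace XMLPolicy

/-! ### Structured DTDs -/

/-- Right-hand sides of productions:
`str | ε | B₁, …, Bₙ | B₁ + ⋯ + Bₙ | B*`. -/
inductive ContentModel (L : Type*) where
  | str : ContentModel L
  | eps : ContentModel L
  | seq : List L → ContentModel L
  | alt : List L → ContentModel L
  | star : L → ContentModel L

/-- Labels of tree nodes: an element type, or the text label `str`. -/
inductive NodeLabel (L : Type*) where
  | elem : L → NodeLabel L
  | str : NodeLabel L

namespace ContentModel

variable {L : Type*}

/-- The element types occurring in a content model. -/
def types : ContentModel L → List L
  | str => []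
  | eps => []
  | seq Bs => Bs
  | alt Bs => Bs
  | star B => [B]

/-- In `B₁, …, Bₙ` and `B₁ + ⋯ + Bₙ` one has `n ≥ 1` and the `Bᵢ` are distinct. -/
def WellFormed (c : ContentModel L) : Prop :=
  c.types.Nodup ∧ c ≠ seq [] ∧ c ≠ alt []

/-- The language of a content model, as a set of words over the node labels. -/
def language : ContentModel L → Set (List (NodeLabel L))
  | str => {[NodeLabel.str]}
  | eps => {[]}
  | seq Bs => {Bs.map NodeLabel.elem}
  | alt Bs => {w | ∃ B ∈ Bs, w = [NodeLabel.elem B]}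
  | star B => {w | ∃ k : ℕ, w = List.replicate k (NodeLabel.elem B)}

end ContentModel

/-- A DTD `(Ele, Rg, rt)`; the values of `Rg` outside `Ele` are irrelevant. -/
structure DTD (L : Type*) where
  Ele : Finset L
  Rg : L → ContentModel L
  rt : L
  rt_mem : rt ∈ Ele
  rg_mem : ∀ A ∈ Ele, ∀ B ∈ (Rg A).types, B ∈ Ele
  rg_wellFormed : ∀ A ∈ Ele, (Rg A).WellFormed

namespace DTD

variable {L : Type*}

/-- `B` is a subelement type of `A`. -/
def Sub (D : DTD L) (A B : L) : Prop := A ∈ D.Ele ∧ B ∈ (D.Rg A).types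

/-- `A ≤_D B`: the reflexive transitive closure of the subelement relation. -/
def Le (D : DTD L) : L → L → Prop := Relation.ReflTransGen D.Sub

/-- The DTD graph is acyclic. -/
def NonRecursive (D : DTD L) : Prop := ∀ A, ¬ Relation.TransGen D.Sub A A

/-- Every element type is reachable from the root type in the DTD graph. -/
def AllReachable (D : DTD L) : Prop := ∀ A ∈ D.Ele, D.Le D.rt A

end DTD

/-! ### XML trees -/

/-- The data `(N, E, λ, r, v)` of an XML tree, with node identifiers in `ℕ`.
The values of `label` outside `nodes`, and of `val` outside the nodes of `nodes` labeled `str`,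
are irrelevant. That the data form a finite rooted tree is `TreeData.IsTree`. -/
structure TreeData (L : Type*) where
  nodes : Set ℕ
  edge : ℕ → ℕ → Prop
  label : ℕ → NodeLabel L
  root : ℕ
  val : ℕ → String

namespace TreeData

variable {L : Type*}

/-- A finite rooted tree. -/
structure IsTree (t : TreeData L) : Prop where
  finite : t.nodes.Finite
  root_mem : t.root ∈ t.nodes
  edge_mem : ∀ x y, t.edge x y → x ∈ t.nodes ∧ y ∈ t.nodes
  root_no_parent : ∀ x, ¬ t.edge x t.root
  parent_unique : ∀ x x' y, t.edge x y → t.edge x' y → x = x'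
  reachable : ∀ x ∈ t.nodes, Relation.ReflTransGen t.edge t.root x

/-- The descendants of `n`, including `n` itself. -/
def desc (t : TreeData L) (n : ℕ) : Set ℕ := {m | Relation.ReflTransGen t.edge n m}

/-- `t` is a tree that conforms to `D` at element type `A`, i.e. `t ∈ I_D(A)`. Trees are
unordered, so the children of a node may be listed in any order. -/
structure ConformsAt (t : TreeData L) (D : DTD L) (A : L) : Prop where
  isTree : t.IsTree
  root_label : t.label t.root = NodeLabel.elem A
  elem_node : ∀ n ∈ t.nodes, ∀ B, t.label n = NodeLabel.elem B →
    B ∈ D.Ele ∧ ∃ cs : List ℕ, cs.Nodup ∧ (∀ m, m ∈ cs ↔ t.edge n m) ∧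
      cs.map t.label ∈ (D.Rg B).language
  str_leaf : ∀ n ∈ t.nodes, t.label n = NodeLabel.str → ∀ m, ¬ t.edge n m

/-- `t` conforms to `D`, i.e. `t ∈ I_D = I_D(rt)`. -/
def Conforms (t : TreeData L) (D : DTD L) : Prop := t.ConformsAt D D.rt

/-- XML tree isomorphism `t₁ ≡ t₂`. -/
def Iso (t₁ t₂ : TreeData L) : Prop :=
  ∃ h : ℕ → ℕ, Set.BijOn h t₁.nodes t₂.nodes ∧ h t₁.root = t₂.root ∧
    (∀ x ∈ t₁.nodes, ∀ y ∈ t₁.nodes, (t₁.edge x y ↔ t₂.edge (h x) (h y))) ∧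
    (∀ x ∈ t₁.nodes, t₁.label x = t₂.label (h x)) ∧
    (∀ x ∈ t₁.nodes, t₁.label x = NodeLabel.str → t₁.val x = t₂.val (h x))

end TreeData

/-! ### Atomic updates -/

/-- `insert(n, t')`, `delete(n)`, `replace(n, t')` and `replace(n, s)`. -/
inductive Update (L : Type*) where
  | insert : ℕ → TreeData L → Update L
  | delete : ℕ → Update L
  | replace : ℕ → TreeData L → Update L
  | replaceText : ℕ → String → Update L

namespace Update

variable {L : Type*}

/-- `op` is valid with respect to `t`. -/
def Valid (t : TreeData L) : Update L → Prop
  | insert n u => n ∈ t.nodes ∧ Disjoint t.nodes u.nodes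
  | delete n => n ∈ t.nodes
  | replace n u => n ∈ t.nodes ∧ Disjoint t.nodes u.nodes
  | replaceText n _ => n ∈ t.nodes

open Classical in
/-- The result `⟦op⟧(t)` of applying `op` to `t`. The edges removed together with the subtree at
`n` are the ones that end in this subtree: those inside it and the one from the parent of `n`. -/
noncomputable def apply (t : TreeData L) : Update L → TreeData L
  | insert n u =>
    { nodes := t.nodes ∪ u.nodes
      edge := fun x y => t.edge x y ∨ u.edge x y ∨ (x = n ∧ y = u.root)
      label := fun m => if m ∈ u.nodes then u.label m else t.label m
      root := t.root
      val := fun m => if m ∈ u.nodes then u.val m else t.val m }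
  | delete n =>
    { nodes := t.nodes \ t.desc n
      edge := fun x y => t.edge x y ∧ y ∉ t.desc n
      label := t.label
      root := t.root
      val := t.val }
  | replace n u =>
    { nodes := (t.nodes \ t.desc n) ∪ u.nodes
      edge := fun x y => (t.edge x y ∧ y ∉ t.desc n) ∨ u.edge x y ∨ (t.edge x n ∧ y = u.root)
      label := fun m => if m ∈ u.nodes then u.label m else t.label m
      root := t.root
      val := fun m => if m ∈ u.nodes then u.val m else t.val m }
  | replaceText n s =>
    { t with val := Function.update t.val n s }

/-- The result `⟦op₁; …; opₙ⟧(t)` of applying a sequence of updates. -/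
noncomputable def applySeq (t : TreeData L) : List (Update L) → TreeData L
  | [] => t
  | op :: ops => applySeq (apply t op) ops

end Update

/-! ### Update access types -/

/-- The operation part of an update access type. -/
inductive UATOp (L : Type*) where
  | insert : L → UATOp L
  | delete : L → UATOp L
  | replace : L → L → UATOp L
  | replaceText : UATOp L

/-- Update access types `(A, op)`. -/
abbrev UAT (L : Type*) := L × UATOp L

/-- `op` matches `uat` on `t`. -/
inductive Matches {L : Type*} (D : DTD L) (t : TreeData L) : Update L → UAT L → Prop where
  | insert {n : ℕ} {u : TreeData L} {A B : L} :
      t.label n = NodeLabel.elem A → u.ConformsAt D B →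
      Matches D t (Update.insert n u) (A, UATOp.insert B)
  | delete {n p : ℕ} {A B : L} :
      t.label n = NodeLabel.elem B → t.edge p n → t.label p = NodeLabel.elem A →
      Matches D t (Update.delete n) (A, UATOp.delete B)
  | replace {n p : ℕ} {u : TreeData L} {A B B' : L} :
      t.label n = NodeLabel.elem B → u.ConformsAt D B' →
      t.edge p n → t.label p = NodeLabel.elem A → B ≠ B' →
      Matches D t (Update.replace n u) (A, UATOp.replace B B')
  | replaceText {n p : ℕ} {s : String} {A : L} :
      t.label n = NodeLabel.str → t.edge p n → t.label p = NodeLabel.elem A →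
      Matches D t (Update.replaceText n s) (A, UATOp.replaceText)

/-- `uat valid in D`. -/
inductive IsValidUAT {L : Type*} (D : DTD L) : UAT L → Prop where
  | insert {A B : L} : A ∈ D.Ele → D.Rg A = ContentModel.star B →
      IsValidUAT D (A, UATOp.insert B)
  | delete {A B : L} : A ∈ D.Ele → D.Rg A = ContentModel.star B →
      IsValidUAT D (A, UATOp.delete B)
  | replace {A B B' : L} {Bs : List L} : A ∈ D.Ele → D.Rg A = ContentModel.alt Bs →
      B ∈ Bs → B' ∈ Bs → B ≠ B' → IsValidUAT D (A, UATOp.replace B B')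
  | replaceText {A : L} : A ∈ D.Ele → D.Rg A = ContentModel.str →
      IsValidUAT D (A, UATOp.replaceText)

/-- `⟦S⟧(t)`: the atomic updates that match some member of `S` on `t`. -/
def matching {L : Type*} (D : DTD L) (S : Set (UAT L)) (t : TreeData L) : Set (Update L) :=
  {op | ∃ uat ∈ S, Matches D t op uat}

/-- The update sequence is valid on `t` and each of its updates matches a member of `S` on the
tree to which that update is applied. -/
def AllowedSeq {L : Type*} (D : DTD L) (S : Set (UAT L)) : TreeData L → List (Update L) → Prop
  | _, [] => True
  | t, op :: ops =>
    op.Valid t ∧ op ∈ matching D S t ∧ AllowedSeq D S (Update.apply t op) ops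

namespace DTD

variable {L : Type*}

/-- `valid(D)`. -/
def valid (D : DTD L) : Set (UAT L) := {uat | IsValidUAT D uat}

/-- The edges of the replace graph `𝒢_A(S)`. -/
def ReplaceEdge (S : Set (UAT L)) (A B B' : L) : Prop := (A, UATOp.replace B B') ∈ S

/-- The edges of the transitive closure `𝒢_A⁺(S)` of the replace graph. -/
def ReplaceEdgePlus (S : Set (UAT L)) (A : L) : L → L → Prop :=
  Relation.TransGen (ReplaceEdge S A)

/-- The operator `T`. -/
def T (D : DTD L) (S : Set (UAT L)) : Set (UAT L) :=
  S ∪ {uat | uat ∈ D.valid ∧ ∃ A ∈ D.Ele, ∃ B, D.Rg A = ContentModel.star B ∧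
        (A, UATOp.insert B) ∈ S ∧ (A, UATOp.delete B) ∈ S ∧ D.Le B uat.1}
    ∪ {uat | uat ∈ D.valid ∧ ∃ A ∈ D.Ele, ∃ Bs, D.Rg A = ContentModel.alt Bs ∧
        ∃ B ∈ Bs, ReplaceEdgePlus S A B B ∧ D.Le B uat.1}
    ∪ {uat | uat ∈ D.valid ∧ ∃ A ∈ D.Ele, ∃ Bs, D.Rg A = ContentModel.alt Bs ∧
        ∃ B ∈ Bs, ∃ B' ∈ Bs, ReplaceEdgePlus S A B B' ∧ uat = (A, UATOp.replace B B')}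

end DTD

/-! ### Security policies -/

/-- A security policy `(𝒜, ℱ)` over `D`. -/
structure Policy {L : Type*} (D : DTD L) where
  allowed : Set (UAT L)
  forbidden : Set (UAT L)
  allowed_valid : allowed ⊆ D.valid
  forbidden_valid : forbidden ⊆ D.valid
  disjoint : Disjoint allowed forbidden

namespace Policy

variable {L : Type*} {D : DTD L}

def IsTotal (P : Policy D) : Prop := P.allowed ∪ P.forbidden = D.valid

/-- `P ⊑ Q`: the policy `Q` extends `P`. -/
def ExtendedBy (P Q : Policy D) : Prop :=
  P.allowed ⊆ Q.allowed ∧ P.forbidden ⊆ Q.forbidden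

/-- No forbidden update that has an effect on a conforming tree can be simulated by an allowed
sequence. The clause `¬ (Update.apply t op₀).Iso t` only sets aside the replacement of a text value by
the very same value. -/
def Consistent (P : Policy D) : Prop :=
  ∀ t : TreeData L, t.Conforms D →
    ¬ ∃ (ops : List (Update L)) (op₀ : Update L),
      AllowedSeq D P.allowed t ops ∧
      op₀.Valid t ∧ op₀ ∈ matching D P.forbidden t ∧
      ¬ (Update.apply t op₀).Iso t ∧
      (Update.applySeq t ops).Iso (Update.apply t op₀)

/-- `P` has a consistent total extension. -/
def Quasiconsistent (P : Policy D) : Prop :=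
  ∃ Q : Policy D, P.ExtendedBy Q ∧ Q.IsTotal ∧ Q.Consistent

end Policy

end XMLPolicy

/-!
Two implications carry the theorem: every access type that `T(S)` adds to `S` has an effective
update that can be simulated by updates in `S`, and no effective update of a valid access type
outside `T(S)` can be simulated by updates in `T(S)`. The first shows that a consistent policy has
`T(𝒜) ∩ ℱ = ∅`, the second that `(T(𝒜), valid(D) ∖ T(𝒜))` is consistent. A policy with a consistent
extension is itself consistent.

*Simulation* (`exists_simulation`). If children labeled `B` of a node labeled `A` can be deleted
and inserted, or if `B` lies on a cycle of `𝒢_A(S)`, the whole subtree at such a child can be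
exchanged for an arbitrary tree conforming at `B`: in the first case it is deleted and the new tree
inserted, in the second it is replaced along the cycle. An update somewhere in this subtree is
simulated by exchanging the subtree for the one that results from the update (`Step.same_replace`).
Since the old subtree is removed first, its node identifiers may be used again, and the outcome
agrees with that of the update. A replacement that belongs to `T(S)` because of a path of `𝒢_A(S)`
is simulated by the replacements along this path. A conforming tree with the required nodes exists
because the DTD is non-recursive and every type is reachable (`exists_conformsAt_of_le`).

*Impossibility* (`not_iso_of_notMem_T`). Let an update of type `(C, op) ∉ T(S)` act at a node `c`
of `t`, and let a sequence of updates in `T(S)` lead from `t` to a tree isomorphic to its result.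
Isomorphisms preserve the label path from the root to a node, so the number of nodes with a given
label path is the same in both outcomes; up to the depth of `c` it is also the same as in `t`. By
induction along the path from the root to `c`, no update of the sequence creates or destroys a node
whose label path is that of `c` or of an ancestor of `c` (`pathNodes_frozen`). Below a type with
production `B*`, insertion and deletion of `B` cannot both be allowed, as otherwise everything
below `B`, including `(C, op)`, would belong to `T(S)`; so the set of the `B`-nodes in question
changes monotonically, and it is constant because its cardinality returns to its initial value.
Below a type `X` with production `B₁ + ⋯ + Bₙ`, the number of `X`-nodes whose child has a type in a
set closed under the allowed replacements cannot decrease. The type `B` on the path to `c` does not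
lie on a cycle, so the set of the types reachable from `B` is closed with and without `B`, and both
numbers are constant; hence no child labeled `B` is ever replaced or created. Once the nodes with
the label path of `c` are known to persist, the same monotone quantities, or the text values of
their children, separate the two outcomes.
-/

namespace XMLPolicy

open Relation

variable {L : Type*} {D : DTD L} {t t' u v : TreeData L}

/-! ### Trees and subtrees -/

theorem reflTransGen_imp {α : Type*} {r s : α → α → Prop} (h : ∀ x y, r x y → s x y) {x y : α}
    (hxy : ReflTransGen r x y) : ReflTransGen s x y :=
  ReflTransGen.mono h _ _ hxy

namespace TreeData

theorem IsTree.acyclic (ht : t.IsTree) {x : ℕ} : ¬ TransGen t.edge x x := by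
  intro h
  have hx : x ∈ t.nodes := by
    obtain ⟨y, hy, -⟩ := TransGen.head'_iff.1 h
    exact (ht.edge_mem _ _ hy).1
  have hr := ht.reachable x hx
  clear hx
  induction hr with
  | refl =>
    obtain ⟨y, _, hy⟩ := TransGen.tail'_iff.1 h
    exact ht.root_no_parent _ hy
  | tail _ h2 ih =>
    obtain ⟨y, hy, hyz⟩ := TransGen.tail'_iff.1 h
    obtain rfl := ht.parent_unique _ _ _ hyz h2
    exact ih (TransGen.head' h2 hy)

theorem IsTree.desc_subset (ht : t.IsTree) {n : ℕ} (hn : n ∈ t.nodes) : t.desc n ⊆ t.nodes := by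
  intro y hy
  rcases ReflTransGen.cases_tail hy with rfl | ⟨z, _, hz⟩
  · exact hn
  · exact (ht.edge_mem _ _ hz).2

theorem self_mem_desc (t : TreeData L) (n : ℕ) : n ∈ t.desc n := ReflTransGen.refl

theorem mem_desc_of_edge {n x y : ℕ} (hx : x ∈ t.desc n) (h : t.edge x y) : y ∈ t.desc n :=
  ReflTransGen.tail hx h

theorem IsTree.parent_mem_desc (ht : t.IsTree) {n x y : ℕ} (hy : y ∈ t.desc n) (hne : y ≠ n)
    (h : t.edge x y) : x ∈ t.desc n := by
  rcases ReflTransGen.cases_tail hy with rfl | ⟨z, hz, hzy⟩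
  · exact absurd rfl hne
  · obtain rfl := ht.parent_unique _ _ _ h hzy
    exact hz

theorem IsTree.parent_notMem_desc (ht : t.IsTree) {p n : ℕ} (h : t.edge p n) : p ∉ t.desc n :=
  fun hp => ht.acyclic (TransGen.head' h hp)

theorem IsTree.root_notMem_desc (ht : t.IsTree) {p n : ℕ} (h : t.edge p n) :
    t.root ∉ t.desc n := by
  intro hr
  rcases ReflTransGen.cases_tail hr with e | ⟨z, _, hz⟩
  · exact ht.root_no_parent p (by rw [e]; exact h)
  · exact ht.root_no_parent _ hz

theorem IsTree.reach_of_edge (ht : t.IsTree) {x y : ℕ} (hx : x ∈ t.nodes)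
    (h : ReflTransGen t.edge x y) : y ∈ t.nodes := ht.desc_subset hx h

/-- The condition that conformity to `D` imposes on the node `n` and its children. -/
def LocallyConforms (D : DTD L) (t : TreeData L) (n : ℕ) : Prop :=
  (∀ B, t.label n = NodeLabel.elem B →
    B ∈ D.Ele ∧ ∃ cs : List ℕ, cs.Nodup ∧ (∀ m, m ∈ cs ↔ t.edge n m) ∧
      cs.map t.label ∈ (D.Rg B).language) ∧
  (t.label n = NodeLabel.str → ∀ m, ¬ t.edge n m)

theorem conformsAt_iff {A : L} : t.ConformsAt D A ↔
    t.IsTree ∧ t.label t.root = NodeLabel.elem A ∧ ∀ n ∈ t.nodes, LocallyConforms D t n :=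
  ⟨fun h => ⟨h.isTree, h.root_label, fun n hn => ⟨h.elem_node n hn, h.str_leaf n hn⟩⟩,
   fun h => ⟨h.1, h.2.1, fun n hn => (h.2.2 n hn).1, fun n hn => (h.2.2 n hn).2⟩⟩

/-- Local conformity only depends on the label of the node, its children and their labels. -/
theorem LocallyConforms.congr {n : ℕ} (h : LocallyConforms D t n) (hl : t'.label n = t.label n)
    (he : ∀ m, t'.edge n m ↔ t.edge n m) (hc : ∀ m, t.edge n m → t'.label m = t.label m) :
    LocallyConforms D t' n := by
  refine ⟨fun B hB => ?_, fun hs m hm => h.2 (hl ▸ hs) m ((he m).1 hm)⟩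
  obtain ⟨hB', cs, hcs, hm, hw⟩ := h.1 B (hl ▸ hB)
  refine ⟨hB', cs, hcs, fun m => (hm m).trans (he m).symm, ?_⟩
  rwa [List.map_congr_left fun m hmc => hc m ((hm m).1 hmc)]

theorem ConformsAt.star_child {R A B : L} (ht : t.ConformsAt D R) {x y : ℕ} (hx : x ∈ t.nodes)
    (hl : t.label x = NodeLabel.elem A) (hR : D.Rg A = ContentModel.star B) (hy : t.edge x y) :
    t.label y = NodeLabel.elem B := by
  obtain ⟨-, cs, -, hcs, hw⟩ := ht.elem_node x hx A hl
  rw [hR] at hw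
  obtain ⟨k, hk⟩ := hw
  exact List.eq_of_mem_replicate (hk ▸ List.mem_map_of_mem ((hcs y).2 hy))

theorem ConformsAt.alt_child {R A : L} {Bs : List L} (ht : t.ConformsAt D R) {x y z : ℕ}
    (hx : x ∈ t.nodes) (hl : t.label x = NodeLabel.elem A) (hR : D.Rg A = ContentModel.alt Bs)
    (hy : t.edge x y) (hz : t.edge x z) : y = z := by
  obtain ⟨-, cs, -, hcs, hw⟩ := ht.elem_node x hx A hl
  rw [hR] at hw
  obtain ⟨B, -, hB⟩ := hw
  obtain ⟨a, rfl⟩ := List.length_eq_one_iff.1 (by simpa using congrArg List.length hB)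
  rw [List.mem_singleton.1 ((hcs y).2 hy), List.mem_singleton.1 ((hcs z).2 hz)]

/-- The label of a child is a subelement type of the label of its parent, or the label `str` below
a type with production `str`. -/
theorem ConformsAt.child_label {R A : L} (ht : t.ConformsAt D R) {x y : ℕ} (hx : x ∈ t.nodes)
    (hl : t.label x = NodeLabel.elem A) (hy : t.edge x y) :
    (∃ B, t.label y = NodeLabel.elem B ∧ D.Sub A B) ∨
      (D.Rg A = ContentModel.str ∧ t.label y = NodeLabel.str) := by
  obtain ⟨hA, cs, -, hcs, hw⟩ := ht.elem_node x hx A hl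
  have hm : t.label y ∈ cs.map t.label := List.mem_map_of_mem ((hcs y).2 hy)
  unfold DTD.Sub
  cases hR : D.Rg A with
  | str =>
    rw [hR] at hw
    rw [show cs.map t.label = [NodeLabel.str] from hw] at hm
    exact Or.inr ⟨rfl, List.mem_singleton.1 hm⟩
  | eps =>
    rw [hR] at hw
    rw [show cs.map t.label = [] from hw] at hm
    simp at hm
  | seq Bs =>
    rw [hR] at hw
    rw [show cs.map t.label = Bs.map NodeLabel.elem from hw] at hm
    obtain ⟨B, hB, e⟩ := List.mem_map.1 hm
    exact Or.inl ⟨B, e.symm, hA, hB⟩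
  | alt Bs =>
    rw [hR] at hw
    obtain ⟨B, hB, e⟩ := hw
    rw [e] at hm
    exact Or.inl ⟨B, List.mem_singleton.1 hm, hA, hB⟩
  | star B =>
    rw [hR] at hw
    obtain ⟨k, e⟩ := hw
    rw [e] at hm
    exact Or.inl ⟨B, List.eq_of_mem_replicate hm, hA, List.mem_singleton_self B⟩

theorem ConformsAt.exists_elem_of_edge {R : L} (ht : t.ConformsAt D R) {x y : ℕ}
    (h : t.edge x y) : ∃ A, t.label x = NodeLabel.elem A := by
  cases hl : t.label x with
  | elem A => exact ⟨A, rfl⟩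
  | str => exact absurd h (ht.str_leaf x (ht.isTree.edge_mem _ _ h).1 hl y)

theorem IsTree.insert (ht : t.IsTree) (hu : u.IsTree) {n : ℕ} (hn : n ∈ t.nodes)
    (hd : Disjoint t.nodes u.nodes) : (Update.apply t (Update.insert n u)).IsTree := by
  have hd' : ∀ x, x ∈ t.nodes → x ∉ u.nodes := fun _ h => Set.disjoint_left.1 hd h
  refine ⟨ht.finite.union hu.finite, Or.inl ht.root_mem, ?_, ?_, ?_, ?_⟩
  · rintro x y (h | h | ⟨rfl, rfl⟩)
    · exact ⟨Or.inl (ht.edge_mem _ _ h).1, Or.inl (ht.edge_mem _ _ h).2⟩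
    · exact ⟨Or.inr (hu.edge_mem _ _ h).1, Or.inr (hu.edge_mem _ _ h).2⟩
    · exact ⟨Or.inl hn, Or.inr hu.root_mem⟩
  · rintro x (h | h | ⟨_, h⟩)
    · exact ht.root_no_parent _ h
    · exact hd' _ ht.root_mem (hu.edge_mem _ _ h).2
    · exact hd' _ ht.root_mem (show t.root ∈ u.nodes by
        rw [show t.root = u.root from h]; exact hu.root_mem)
  · rintro x x' y (h | h | ⟨rfl, rfl⟩) (h' | h' | ⟨rfl, e⟩)
    · exact ht.parent_unique _ _ _ h h'
    · exact absurd (hu.edge_mem _ _ h').2 (hd' _ (ht.edge_mem _ _ h).2)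
    · exact absurd (e ▸ hu.root_mem) (hd' _ (ht.edge_mem _ _ h).2)
    · exact absurd (hu.edge_mem _ _ h).2 (hd' _ (ht.edge_mem _ _ h').2)
    · exact hu.parent_unique _ _ _ h h'
    · exact absurd (e ▸ h) (hu.root_no_parent _)
    · exact absurd hu.root_mem (hd' _ (ht.edge_mem _ _ h').2)
    · exact absurd h' (hu.root_no_parent _)
    · rfl
  · have key : ∀ x ∈ t.nodes,
        ReflTransGen (Update.apply t (Update.insert n u)).edge t.root x := fun x hx =>
      reflTransGen_imp (fun _ _ h => Or.inl h) (ht.reachable x hx)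
    rintro x (hx | hx)
    · exact key x hx
    · refine ((key n hn).tail (Or.inr (Or.inr ⟨rfl, rfl⟩))).trans ?_
      exact reflTransGen_imp (fun _ _ h => Or.inr (Or.inl h)) (hu.reachable x hx)

theorem IsTree.delete (ht : t.IsTree) {p n : ℕ} (hp : t.edge p n) :
    (Update.apply t (Update.delete n)).IsTree := by
  refine ⟨ht.finite.subset Set.sdiff_subset, ⟨ht.root_mem, ht.root_notMem_desc hp⟩, ?_, ?_, ?_, ?_⟩
  · rintro x y ⟨h, hy⟩
    exact ⟨⟨(ht.edge_mem _ _ h).1, fun hx => hy (mem_desc_of_edge hx h)⟩, (ht.edge_mem _ _ h).2, hy⟩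
  · exact fun x h => ht.root_no_parent x h.1
  · exact fun x x' y h h' => ht.parent_unique _ _ _ h.1 h'.1
  · rintro x ⟨hx, hxn⟩
    have hr := ht.reachable x hx
    clear hx
    show ReflTransGen _ t.root x
    induction hr with
    | refl => exact ReflTransGen.refl
    | tail _ h ih => exact (ih fun hy => hxn (mem_desc_of_edge hy h)).tail ⟨h, hxn⟩

/-- Below the parent `p` of `n`, replacing the subtree at `n` amounts to deleting it and inserting
the new subtree at `p`. -/
theorem IsTree.insert_delete (ht : t.IsTree) {p n : ℕ} (hp : t.edge p n) (u : TreeData L) :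
    Update.apply (Update.apply t (Update.delete n)) (Update.insert p u) =
      Update.apply t (Update.replace n u) := by
  have : ∀ x, x = p ↔ t.edge x n :=
    fun x => ⟨fun h => h ▸ hp, fun h => ht.parent_unique _ _ _ h hp⟩
  simp only [Update.apply, this]

theorem IsTree.replace (ht : t.IsTree) (hu : u.IsTree) {p n : ℕ} (hp : t.edge p n)
    (hd : Disjoint (t.nodes \ t.desc n) u.nodes) :
    (Update.apply t (Update.replace n u)).IsTree := by
  rw [← ht.insert_delete hp]
  exact (ht.delete hp).insert hu ⟨(ht.edge_mem _ _ hp).1, ht.parent_notMem_desc hp⟩ hd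

theorem IsTree.replaceText (ht : t.IsTree) (n : ℕ) (s : String) :
    (Update.apply t (Update.replaceText n s)).IsTree :=
  ⟨ht.finite, ht.root_mem, ht.edge_mem, ht.root_no_parent, ht.parent_unique, ht.reachable⟩

end TreeData

open TreeData

/-! ### The effect of an atomic update -/

/-- `t'` is obtained from the tree `t` by an atomic update that matches `(A, o)`. The update acts at
the node `c`: it changes the children of `c`, and nothing but descendants of `c`. Nodes belonging to
both trees keep their parents and labels. -/
structure Step (D : DTD L) (t t' : TreeData L) (A : L) (o : UATOp L) (c : ℕ) : Prop where
  isTree' : t'.IsTree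
  root_eq : t'.root = t.root
  mem : c ∈ t.nodes
  mem' : c ∈ t'.nodes
  label_c : t.label c = NodeLabel.elem A
  edge_old : ∀ x y, y ∈ t.nodes → y ∈ t'.nodes → (t'.edge x y ↔ t.edge x y)
  label_old : ∀ y, y ∈ t.nodes → y ∈ t'.nodes → t'.label y = t.label y
  val_old : ∀ y, y ∈ t.nodes → y ∈ t'.nodes →
    t'.val y = t.val y ∨ (o = UATOp.replaceText ∧ t.edge c y)
  new_desc : ∀ y, y ∈ t'.nodes → y ∉ t.nodes → TransGen t'.edge c y
  old_desc : ∀ y, y ∈ t.nodes → y ∉ t'.nodes → TransGen t.edge c y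
  new_child : ∀ x y, t'.edge x y → x ∈ t.nodes → y ∉ t.nodes → x = c ∧
    ∃ B', t'.label y = NodeLabel.elem B' ∧
      (o = UATOp.insert B' ∨ ∃ B, o = UATOp.replace B B' ∧ B ≠ B')
  old_child : ∀ x y, t.edge x y → x ∈ t'.nodes → y ∉ t'.nodes → x = c ∧
    ∃ B, t.label y = NodeLabel.elem B ∧
      (o = UATOp.delete B ∨ ∃ B', o = UATOp.replace B B' ∧ B ≠ B')
  gains : ∀ B', (o = UATOp.insert B' ∨ ∃ B, o = UATOp.replace B B') →
    ∃ m, t'.edge c m ∧ t'.label m = NodeLabel.elem B' ∧ m ∉ t.nodes ∧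
      ∀ y, t'.edge c y → y ∉ t.nodes → y = m
  loses : ∀ B, (o = UATOp.delete B ∨ ∃ B', o = UATOp.replace B B') →
    ∃ m, t.edge c m ∧ t.label m = NodeLabel.elem B ∧ m ∉ t'.nodes
  text : o = UATOp.replaceText → ∃ n s, t.edge c n ∧ t.label n = NodeLabel.str ∧
    t' = { t with val := Function.update t.val n s }
  new_ok : ∀ x, x ∈ t'.nodes → x ∉ t.nodes → LocallyConforms D t' x

theorem Step.of_insert (ht : t.IsTree) {n : ℕ} {A B : L} (hn : n ∈ t.nodes)
    (hd : Disjoint t.nodes u.nodes) (hl : t.label n = NodeLabel.elem A) (hu : u.ConformsAt D B) :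
    Step D t (Update.apply t (Update.insert n u)) A (UATOp.insert B) n := by
  have hd' : ∀ x, x ∈ t.nodes → x ∉ u.nodes := fun _ h => Set.disjoint_left.1 hd h
  have hur := hu.isTree.root_mem
  refine ⟨ht.insert hu.isTree hn hd, rfl, hn, Or.inl hn, hl, ?_, ?_, ?_, ?_, ?_, ?_, ?_, ?_, ?_, ?_,
    ?_⟩
  · intro x y hy _
    refine ⟨?_, Or.inl⟩
    rintro (h | h | ⟨rfl, rfl⟩)
    · exact h
    · exact absurd (hu.isTree.edge_mem _ _ h).2 (hd' _ hy)
    · exact absurd hur (hd' _ hy)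
  · exact fun y hy _ => if_neg (hd' _ hy)
  · exact fun y hy _ => Or.inl (if_neg (hd' _ hy))
  · rintro y (hy | hy) hy'
    · exact absurd hy hy'
    · exact TransGen.head' (Or.inr (Or.inr ⟨rfl, rfl⟩))
        (reflTransGen_imp (fun _ _ h => Or.inr (Or.inl h)) (hu.isTree.reachable y hy))
  · exact fun y hy hy' => absurd (Or.inl hy) hy'
  · rintro x y (h | h | ⟨rfl, rfl⟩) hx hy
    · exact absurd (ht.edge_mem _ _ h).2 hy
    · exact absurd (hu.isTree.edge_mem _ _ h).1 (hd' _ hx)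
    · exact ⟨rfl, B, (if_pos hur).trans hu.root_label, Or.inl rfl⟩
  · exact fun x y h _ hy => absurd (Or.inl (ht.edge_mem _ _ h).2) hy
  · rintro B' (h | ⟨_, h⟩) <;> cases h
    refine ⟨u.root, Or.inr (Or.inr ⟨rfl, rfl⟩), (if_pos hur).trans hu.root_label,
      fun h => hd' _ h hur, ?_⟩
    rintro y (h | h | ⟨_, rfl⟩) hy
    · exact absurd (ht.edge_mem _ _ h).2 hy
    · exact absurd (hu.isTree.edge_mem _ _ h).1 (hd' _ hn)
    · rfl
  · rintro B' (h | ⟨_, h⟩) <;> cases h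
  · exact fun h => by cases h
  · rintro x (hx | hx) hx'
    · exact absurd hx hx'
    · refine ((conformsAt_iff.1 hu).2.2 x hx).congr (if_pos hx) (fun m => ⟨?_, ?_⟩) ?_
      · rintro (h | h | ⟨rfl, rfl⟩)
        · exact absurd (ht.edge_mem _ _ h).1 hx'
        · exact h
        · exact absurd hn hx'
      · exact fun h => Or.inr (Or.inl h)
      · exact fun m hm => if_pos (hu.isTree.edge_mem _ _ hm).2

theorem Step.of_delete (ht : t.IsTree) {p n : ℕ} {A B : L} (hn : t.label n = NodeLabel.elem B)
    (hp : t.edge p n) (hl : t.label p = NodeLabel.elem A) :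
    Step D t (Update.apply t (Update.delete n)) A (UATOp.delete B) p := by
  have hpn := ht.edge_mem _ _ hp
  refine ⟨ht.delete hp, rfl, hpn.1, ⟨hpn.1, ht.parent_notMem_desc hp⟩, hl, ?_, ?_, ?_, ?_, ?_, ?_,
    ?_, ?_, ?_, ?_, ?_⟩
  · exact fun x y _ hy => ⟨fun h => h.1, fun h => ⟨h, hy.2⟩⟩
  · exact fun y _ _ => rfl
  · exact fun y _ _ => Or.inl rfl
  · exact fun y hy hy' => absurd hy.1 hy'
  · exact fun y hy hy' => TransGen.head' hp (by_contra fun h => hy' ⟨hy, h⟩)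
  · exact fun x y h _ hy => absurd (ht.edge_mem _ _ h.1).2 hy
  · intro x y h hx hy
    obtain rfl : y = n := by
      by_contra hne
      exact hx.2 (ht.parent_mem_desc (by_contra fun h' => hy ⟨(ht.edge_mem _ _ h).2, h'⟩) hne h)
    exact ⟨ht.parent_unique _ _ _ h hp, B, hn, Or.inl rfl⟩
  · rintro B' (h | ⟨_, h⟩) <;> cases h
  · rintro B' (h | ⟨_, h⟩) <;> cases h
    exact ⟨n, hp, hn, fun h => h.2 (self_mem_desc t n)⟩
  · exact fun h => by cases h
  · exact fun x hx hx' => absurd hx.1 hx'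

theorem Step.of_replace (ht : t.IsTree) {p n : ℕ} {A B B' : L} (hd : Disjoint t.nodes u.nodes)
    (hn : t.label n = NodeLabel.elem B) (hu : u.ConformsAt D B') (hp : t.edge p n)
    (hl : t.label p = NodeLabel.elem A) (hne : B ≠ B') :
    Step D t (Update.apply t (Update.replace n u)) A (UATOp.replace B B') p := by
  have hd' : ∀ x, x ∈ t.nodes → x ∉ u.nodes := fun _ h => Set.disjoint_left.1 hd h
  have hur := hu.isTree.root_mem
  have hpn := ht.edge_mem _ _ hp
  refine ⟨ht.replace hu.isTree hp (hd.mono_left Set.sdiff_subset), rfl, hpn.1,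
    Or.inl ⟨hpn.1, ht.parent_notMem_desc hp⟩, hl, ?_, ?_, ?_, ?_, ?_, ?_, ?_, ?_, ?_, ?_, ?_⟩
  · intro x y hy hy'
    refine ⟨?_, fun h => Or.inl ⟨h, ?_⟩⟩
    · rintro (h | h | ⟨_, rfl⟩)
      · exact h.1
      · exact absurd (hu.isTree.edge_mem _ _ h).2 (hd' _ hy)
      · exact absurd hur (hd' _ hy)
    · rcases hy' with h | h
      · exact h.2
      · exact absurd h (hd' _ hy)
  · exact fun y hy _ => if_neg (hd' _ hy)
  · exact fun y hy _ => Or.inl (if_neg (hd' _ hy))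
  · rintro y (hy | hy) hy'
    · exact absurd hy.1 hy'
    · exact TransGen.head' (Or.inr (Or.inr ⟨hp, rfl⟩))
        (reflTransGen_imp (fun _ _ h => Or.inr (Or.inl h)) (hu.isTree.reachable y hy))
  · exact fun y hy hy' => TransGen.head' hp (by_contra fun h => hy' (Or.inl ⟨hy, h⟩))
  · rintro x y (h | h | ⟨h, rfl⟩) hx hy
    · exact absurd (ht.edge_mem _ _ h.1).2 hy
    · exact absurd (hu.isTree.edge_mem _ _ h).1 (hd' _ hx)
    · exact ⟨ht.parent_unique _ _ _ h hp, B', (if_pos hur).trans hu.root_label,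
        Or.inr ⟨B, rfl, hne⟩⟩
  · intro x y h hx hy
    have hxn : x ∉ t.desc n := by
      rcases hx with hx | hx
      · exact hx.2
      · exact absurd hx (hd' _ (ht.edge_mem _ _ h).1)
    obtain rfl : y = n := by
      by_contra hne
      exact hxn (ht.parent_mem_desc
        (by_contra fun h' => hy (Or.inl ⟨(ht.edge_mem _ _ h).2, h'⟩)) hne h)
    exact ⟨ht.parent_unique _ _ _ h hp, B, hn, Or.inr ⟨B', rfl, hne⟩⟩
  · rintro B₁ (h | ⟨_, h⟩) <;> cases h
    refine ⟨u.root, Or.inr (Or.inr ⟨hp, rfl⟩), (if_pos hur).trans hu.root_label,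
      fun h => hd' _ h hur, ?_⟩
    rintro y (h | h | ⟨_, rfl⟩) hy
    · exact absurd (ht.edge_mem _ _ h.1).2 hy
    · exact absurd (hu.isTree.edge_mem _ _ h).1 (hd' _ hpn.1)
    · rfl
  · rintro B₁ (h | ⟨_, h⟩) <;> cases h
    refine ⟨n, hp, hn, ?_⟩
    rintro (h | h)
    · exact h.2 (self_mem_desc t n)
    · exact hd' _ hpn.2 h
  · exact fun h => by cases h
  · rintro x (hx | hx) hx'
    · exact absurd hx.1 hx'
    · refine ((conformsAt_iff.1 hu).2.2 x hx).congr (if_pos hx) (fun m => ⟨?_, ?_⟩) ?_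
      · rintro (h | h | ⟨h, rfl⟩)
        · exact absurd (ht.edge_mem _ _ h.1).1 hx'
        · exact h
        · exact absurd (ht.edge_mem _ _ h).1 hx'
      · exact fun h => Or.inr (Or.inl h)
      · exact fun m hm => if_pos (hu.isTree.edge_mem _ _ hm).2

theorem Step.of_replaceText (ht : t.IsTree) {p n : ℕ} {A : L} {s : String}
    (hn : t.label n = NodeLabel.str) (hp : t.edge p n) (hl : t.label p = NodeLabel.elem A) :
    Step D t (Update.apply t (Update.replaceText n s)) A UATOp.replaceText p := by
  have hpn := ht.edge_mem _ _ hp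
  refine ⟨ht.replaceText n s, rfl, hpn.1, hpn.1, hl, fun _ _ _ _ => Iff.rfl, fun _ _ _ => rfl, ?_,
    fun y hy hy' => absurd hy hy', fun y hy hy' => absurd hy hy',
    fun x y h _ hy => absurd (ht.edge_mem _ _ h).2 hy,
    fun x y h _ hy => absurd (ht.edge_mem _ _ h).2 hy, ?_, ?_, fun _ => ⟨n, s, hp, hn, rfl⟩,
    fun x hx hx' => absurd hx hx'⟩
  · intro y _ _
    by_cases h : y = n
    · exact Or.inr ⟨rfl, h ▸ hp⟩
    · exact Or.inl (Function.update_of_ne h _ _)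
  · rintro B' (h | ⟨_, h⟩) <;> cases h
  · rintro B' (h | ⟨_, h⟩) <;> cases h

theorem Matches.step (ht : t.IsTree) {op : Update L} {uat : UAT L} (hv : op.Valid t)
    (hm : Matches D t op uat) : ∃ c, Step D t (Update.apply t op) uat.1 uat.2 c := by
  cases hm with
  | insert hl hu => exact ⟨_, Step.of_insert ht hv.1 hv.2 hl hu⟩
  | delete hn hp hl => exact ⟨_, Step.of_delete ht hn hp hl⟩
  | replace hn hu hp hl hne => exact ⟨_, Step.of_replace ht hv.2 hn hu hp hl hne⟩
  | replaceText hn hp hl => exact ⟨_, Step.of_replaceText ht hn hp hl⟩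

/-- An update matching a valid update access type turns conforming trees into conforming trees. -/
theorem Step.conformsAt {R A : L} {o : UATOp L} {c : ℕ} (h : Step D t t' A o c)
    (ht : t.ConformsAt D R) (hv : (A, o) ∈ D.valid) : t'.ConformsAt D R := by
  have hroot' : t.root ∈ t'.nodes := h.root_eq ▸ h.isTree'.root_mem
  refine conformsAt_iff.2 ⟨h.isTree', ?_, fun x hx => ?_⟩
  · rw [h.root_eq, h.label_old _ ht.isTree.root_mem hroot', ht.root_label]
  by_cases hxt : x ∈ t.nodes
  swap
  · exact h.new_ok x hx hxt
  have hedge : ∀ m, m ∈ t.nodes → m ∈ t'.nodes → (t'.edge x m ↔ t.edge x m) := h.edge_old x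
  have hmem : ∀ {m}, t.edge x m → m ∈ t.nodes := fun hm => (ht.isTree.edge_mem _ _ hm).2
  have hmem' : ∀ {m}, t'.edge x m → m ∈ t'.nodes := fun hm => (h.isTree'.edge_mem _ _ hm).2
  -- without gained or lost children, the local condition is inherited
  have stay : (∀ m, t'.edge x m → m ∈ t.nodes) → (∀ m, t.edge x m → m ∈ t'.nodes) →
      LocallyConforms D t' x := fun h1 h2 =>
    ((conformsAt_iff.1 ht).2.2 x hxt).congr (h.label_old x hxt hx)
      (fun m => ⟨fun hm => (hedge m (h1 m hm) (hmem' hm)).1 hm,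
        fun hm => (hedge m (hmem hm) (h2 m hm)).2 hm⟩)
      (fun m hm => h.label_old m (hmem hm) (h2 m hm))
  by_cases hxc : x = c
  swap
  · exact stay (fun m hm => by_contra fun hn => hxc (h.new_child x m hm hxt hn).1)
      (fun m hm => by_contra fun hn => hxc (h.old_child x m hm hx hn).1)
  subst hxc
  have hl' : t'.label x = NodeLabel.elem A := (h.label_old x hxt hx).trans h.label_c
  obtain ⟨hA, cs, hnd, hcs, hw⟩ := ht.elem_node x hxt A h.label_c
  have conclude : (∃ cs : List ℕ, cs.Nodup ∧ (∀ m, m ∈ cs ↔ t'.edge x m) ∧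
      cs.map t'.label ∈ (D.Rg A).language) → LocallyConforms D t' x := fun hex =>
    ⟨fun B hB => by rw [hl'] at hB; cases hB; exact ⟨hA, hex⟩,
      fun hs => by rw [hl'] at hs; cases hs⟩
  -- at a starred type, any finite set of children labeled `B` will do
  have conclude_star : ∀ B, D.Rg A = ContentModel.star B →
      (∀ y, t'.edge x y → y ∉ t.nodes → t'.label y = NodeLabel.elem B) →
      LocallyConforms D t' x := by
    intro B hR hnew
    have hfin : {m | t'.edge x m}.Finite := h.isTree'.finite.subset fun m hm => hmem' hm
    refine conclude ⟨hfin.toFinset.toList, Finset.nodup_toList _, fun m => by simp, ?_⟩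
    rw [hR]
    refine ⟨_, List.eq_replicate_length.2 fun l hl => ?_⟩
    obtain ⟨m, hm, rfl⟩ := List.mem_map.1 hl
    replace hm : t'.edge x m := by simpa using hm
    by_cases hmt : m ∈ t.nodes
    · rw [h.label_old m hmt (hmem' hm)]
      exact ht.star_child hxt h.label_c hR ((hedge m hmt (hmem' hm)).1 hm)
    · exact hnew m hm hmt
  cases hv with
  | replaceText _ _ =>
    exact stay
      (fun m hm => by_contra fun hn => by
        obtain ⟨-, B', -, h | ⟨_, h, -⟩⟩ := h.new_child x m hm hxt hn <;> cases h)
      (fun m hm => by_contra fun hn => by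
        obtain ⟨-, B', -, h | ⟨_, h, -⟩⟩ := h.old_child x m hm hx hn <;> cases h)
  | @replace _ B B' Bs _ hR hB hB' hne =>
    obtain ⟨n, hn, hnl, hn'⟩ := h.loses B (Or.inr ⟨B', rfl⟩)
    obtain ⟨m, hm, hml, hm', hmu⟩ := h.gains B' (Or.inr ⟨B, rfl⟩)
    refine conclude ⟨[m], List.nodup_singleton m, fun y => ?_, ?_⟩
    · rw [List.mem_singleton]
      refine ⟨fun hy => hy ▸ hm, fun hy => ?_⟩
      by_cases hyt : y ∈ t.nodes
      · have := ht.alt_child hxt h.label_c hR ((hedge y hyt (hmem' hy)).1 hy) hn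
        exact absurd (this ▸ hmem' hy) hn'
      · exact hmu y hy hyt
    · rw [hR]
      exact ⟨B', hB', by simp [hml]⟩
  | @insert _ B _ hR =>
    refine conclude_star B hR fun y hy hyt => ?_
    obtain ⟨-, B', hB', e | ⟨_, e, -⟩⟩ := h.new_child x y hy hxt hyt <;> cases e
    exact hB'
  | @delete _ B _ hR =>
    refine conclude_star B hR fun y hy hyt => ?_
    obtain ⟨-, B', hB', e | ⟨_, e, -⟩⟩ := h.new_child x y hy hxt hyt <;> cases e

/-! ### Isomorphism and label paths -/

namespace TreeData

/-- Equality of trees up to the irrelevant values of `label` and `val` outside the set of nodes. -/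
structure Same (t₁ t₂ : TreeData L) : Prop where
  nodes_eq : t₁.nodes = t₂.nodes
  edge_iff : ∀ x y, t₁.edge x y ↔ t₂.edge x y
  root_eq : t₁.root = t₂.root
  label_eq : ∀ x ∈ t₁.nodes, t₁.label x = t₂.label x
  val_eq : ∀ x ∈ t₁.nodes, t₁.val x = t₂.val x

theorem Same.refl (t : TreeData L) : Same t t :=
  ⟨rfl, fun _ _ => Iff.rfl, rfl, fun _ _ => rfl, fun _ _ => rfl⟩

theorem Same.trans {t₁ t₂ t₃ : TreeData L} (h : Same t₁ t₂) (h' : Same t₂ t₃) : Same t₁ t₃ :=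
  ⟨h.nodes_eq.trans h'.nodes_eq, fun x y => (h.edge_iff x y).trans (h'.edge_iff x y),
    h.root_eq.trans h'.root_eq,
    fun x hx => (h.label_eq x hx).trans (h'.label_eq x (h.nodes_eq ▸ hx)),
    fun x hx => (h.val_eq x hx).trans (h'.val_eq x (h.nodes_eq ▸ hx))⟩

theorem Same.iso {t₁ t₂ : TreeData L} (h : Same t₁ t₂) : t₁.Iso t₂ :=
  ⟨id, h.nodes_eq ▸ Set.bijOn_id _, h.root_eq, fun x _ y _ => h.edge_iff x y, h.label_eq,
    fun x hx _ => h.val_eq x hx⟩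

theorem Iso.refl (t : TreeData L) : t.Iso t := (Same.refl t).iso

theorem Iso.symm {t₁ t₂ : TreeData L} (hroot : t₁.root ∈ t₁.nodes) (h : t₁.Iso t₂) :
    t₂.Iso t₁ := by
  obtain ⟨f, hf, hr, he, hl, hv⟩ := h
  have hg : Set.InvOn (Function.invFunOn f t₁.nodes) f t₁.nodes t₂.nodes := hf.invOn_invFunOn
  have hb : Set.BijOn (Function.invFunOn f t₁.nodes) t₂.nodes t₁.nodes := hf.symm hg.symm
  refine ⟨_, hb, ?_, fun x hx y hy => ?_, fun x hx => ?_, fun x hx hs => ?_⟩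
  · rw [← hr, hg.1 hroot]
  · rw [he _ (hb.mapsTo hx) _ (hb.mapsTo hy), hg.2 hx, hg.2 hy]
  · rw [hl _ (hb.mapsTo hx), hg.2 hx]
  · rw [hv _ (hb.mapsTo hx) (by rwa [hl _ (hb.mapsTo hx), hg.2 hx]), hg.2 hx]

/-- `HasPath t π x`: the node `x` of `t` can be reached from the root, and `π` lists the labels on
the way, starting with the label of `x` and ending with that of the root. -/
inductive HasPath (t : TreeData L) : List (NodeLabel L) → ℕ → Prop where
  | root : HasPath t [t.label t.root] t.root
  | child {π : List (NodeLabel L)} {x y : ℕ} :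
      HasPath t π x → t.edge x y → HasPath t (t.label y :: π) y

theorem HasPath.mem (ht : t.IsTree) {π : List (NodeLabel L)} {x : ℕ} (h : HasPath t π x) :
    x ∈ t.nodes := by
  cases h with
  | root => exact ht.root_mem
  | child _ h => exact (ht.edge_mem _ _ h).2

theorem HasPath.label {l : NodeLabel L} {π : List (NodeLabel L)} {x : ℕ}
    (h : HasPath t (l :: π) x) : t.label x = l := by
  cases h <;> rfl

theorem HasPath.exists_parent {l : NodeLabel L} {π : List (NodeLabel L)} (hπ : π ≠ []) {x : ℕ}
    (h : HasPath t (l :: π) x) : ∃ p, HasPath t π p ∧ t.edge p x := by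
  cases h with
  | root => exact absurd rfl hπ
  | child h he => exact ⟨_, h, he⟩

theorem HasPath.ne_nil {π : List (NodeLabel L)} {x : ℕ} (h : HasPath t π x) : π ≠ [] := by
  cases h <;> simp

theorem hasPath_singleton {l : NodeLabel L} {x : ℕ} :
    HasPath t [l] x ↔ x = t.root ∧ t.label t.root = l := by
  constructor
  · intro h
    generalize hπ : [l] = π at h
    cases h with
    | root => exact ⟨rfl, by simpa using hπ.symm⟩
    | child h _ =>
      cases hπ
      exact absurd rfl h.ne_nil
  · rintro ⟨rfl, rfl⟩
    exact HasPath.root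

theorem HasPath.unique (ht : t.IsTree) {π π' : List (NodeLabel L)} {x : ℕ} (h : HasPath t π x)
    (h' : HasPath t π' x) : π = π' := by
  induction h generalizing π' with
  | root =>
    generalize hx : t.root = x at h'
    cases h' with
    | root => rfl
    | child _ he => exact absurd (hx ▸ he) (ht.root_no_parent _)
  | child h he ih =>
    cases h' with
    | root => exact absurd he (ht.root_no_parent _)
    | child h' he' =>
      obtain rfl := ht.parent_unique _ _ _ he he'
      rw [ih h']

theorem HasPath.extend {σ : List (NodeLabel L)} {x y : ℕ} (h : HasPath t σ x)
    (hxy : ReflTransGen t.edge x y) : ∃ ρ, HasPath t (ρ ++ σ) y := by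
  induction hxy with
  | refl => exact ⟨[], h⟩
  | tail _ he ih =>
    obtain ⟨ρ, hρ⟩ := ih
    exact ⟨_ :: ρ, hρ.child he⟩

theorem IsTree.exists_hasPath (ht : t.IsTree) {x : ℕ} (hx : x ∈ t.nodes) :
    ∃ π, HasPath t π x := by
  obtain ⟨ρ, h⟩ := HasPath.root.extend (ht.reachable x hx)
  exact ⟨_, h⟩

theorem HasPath.length_le (ht : t.IsTree) {σ π : List (NodeLabel L)} {x y : ℕ} (h : HasPath t σ x)
    (hxy : ReflTransGen t.edge x y) (hy : HasPath t π y) : σ.length ≤ π.length := by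
  obtain ⟨ρ, hρ⟩ := h.extend hxy
  rw [hy.unique ht hρ]
  simp

theorem HasPath.length_lt (ht : t.IsTree) {σ π : List (NodeLabel L)} {x y : ℕ} (h : HasPath t σ x)
    (hxy : TransGen t.edge x y) (hy : HasPath t π y) : σ.length < π.length := by
  obtain ⟨z, hz, hzy⟩ := TransGen.head'_iff.1 hxy
  exact (h.child hz).length_le ht hzy hy

/-- The nodes of `t` with label path `π`. -/
def pathNodes (t : TreeData L) (π : List (NodeLabel L)) : Set ℕ := {x | HasPath t π x}

/-- The nodes of `t` with label path `π` that have a child labeled by a member of `U`. -/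
def pathNodesTo (t : TreeData L) (π : List (NodeLabel L)) (U : Set L) : Set ℕ :=
  {x | HasPath t π x ∧ ∃ y, t.edge x y ∧ ∃ B ∈ U, t.label y = NodeLabel.elem B}

/-- The text nodes of `t` with label path `str :: π` and value `s`. -/
def textNodes (t : TreeData L) (π : List (NodeLabel L)) (s : String) : Set ℕ :=
  {x | HasPath t (NodeLabel.str :: π) x ∧ t.val x = s}

theorem IsTree.finite_pathNodes (ht : t.IsTree) (π : List (NodeLabel L)) :
    (t.pathNodes π).Finite := ht.finite.subset fun _ h => HasPath.mem ht h

theorem IsTree.finite_pathNodesTo (ht : t.IsTree) (π : List (NodeLabel L)) (U : Set L) :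
    (t.pathNodesTo π U).Finite := ht.finite.subset fun _ h => h.1.mem ht

theorem IsTree.finite_textNodes (ht : t.IsTree) (π : List (NodeLabel L)) (s : String) :
    (t.textNodes π s).Finite := ht.finite.subset fun _ h => h.1.mem ht

section Iso

variable {h : ℕ → ℕ}

theorem HasPath.map (ht : t.IsTree) (hr : h t.root = t'.root)
    (he : ∀ x ∈ t.nodes, ∀ y ∈ t.nodes, (t.edge x y ↔ t'.edge (h x) (h y)))
    (hl : ∀ x ∈ t.nodes, t.label x = t'.label (h x)) {π : List (NodeLabel L)} {x : ℕ}
    (hx : HasPath t π x) : HasPath t' π (h x) := by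
  induction hx with
  | root => rw [hl _ ht.root_mem, hr]; exact HasPath.root
  | child _ hxy ih =>
    obtain ⟨h1, h2⟩ := ht.edge_mem _ _ hxy
    rw [hl _ h2]
    exact ih.child ((he _ h1 _ h2).1 hxy)

theorem HasPath.exists_of_map (ht : t.IsTree) (ht' : t'.IsTree) (hb : Set.BijOn h t.nodes t'.nodes)
    (hr : h t.root = t'.root)
    (he : ∀ x ∈ t.nodes, ∀ y ∈ t.nodes, (t.edge x y ↔ t'.edge (h x) (h y)))
    (hl : ∀ x ∈ t.nodes, t.label x = t'.label (h x)) {π : List (NodeLabel L)} {y : ℕ}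
    (hy : HasPath t' π y) : ∃ x, h x = y ∧ HasPath t π x := by
  induction hy with
  | root => exact ⟨t.root, hr, by rw [← hr, ← hl _ ht.root_mem]; exact HasPath.root⟩
  | child hp hxy ih =>
    obtain ⟨x, rfl, hx⟩ := ih
    obtain ⟨y, hy, rfl⟩ := hb.surjOn (ht'.edge_mem _ _ hxy).2
    rw [← hl y hy]
    exact ⟨y, rfl, hx.child ((he _ (hx.mem ht) _ hy).2 hxy)⟩

theorem Iso.ncard_pathNodes (ht : t.IsTree) (ht' : t'.IsTree) (h : t.Iso t')
    (π : List (NodeLabel L)) : (t'.pathNodes π).ncard = (t.pathNodes π).ncard := by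
  obtain ⟨h, hb, hr, he, hl, -⟩ := h
  rw [← Set.InjOn.ncard_image (hb.injOn.mono fun x (hx : x ∈ t.pathNodes π) => HasPath.mem ht hx)]
  congr 1
  ext y
  constructor
  · intro hy
    obtain ⟨x, rfl, hx⟩ := HasPath.exists_of_map ht ht' hb hr he hl hy
    exact ⟨x, hx, rfl⟩
  · rintro ⟨x, hx, rfl⟩
    exact HasPath.map ht hr he hl hx

theorem Iso.ncard_pathNodesTo (ht : t.IsTree) (ht' : t'.IsTree) (h : t.Iso t')
    (π : List (NodeLabel L)) (U : Set L) :
    (t'.pathNodesTo π U).ncard = (t.pathNodesTo π U).ncard := by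
  obtain ⟨h, hb, hr, he, hl, -⟩ := h
  rw [← Set.InjOn.ncard_image
    (hb.injOn.mono fun x (hx : x ∈ t.pathNodesTo π U) => hx.1.mem ht)]
  congr 1
  ext y
  constructor
  · rintro ⟨hy, z, hyz, B, hB, hz⟩
    obtain ⟨x, rfl, hx⟩ := HasPath.exists_of_map ht ht' hb hr he hl hy
    obtain ⟨w, hw, rfl⟩ := hb.surjOn (ht'.edge_mem _ _ hyz).2
    exact ⟨x, ⟨hx, w, (he _ (hx.mem ht) _ hw).2 hyz, B, hB, (hl w hw).trans hz⟩, rfl⟩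
  · rintro ⟨x, ⟨hx, w, hw, B, hB, hwB⟩, rfl⟩
    obtain ⟨h1, h2⟩ := ht.edge_mem _ _ hw
    exact ⟨HasPath.map ht hr he hl hx, h w, (he _ h1 _ h2).1 hw, B, hB, (hl _ h2).symm.trans hwB⟩

theorem Iso.ncard_textNodes (ht : t.IsTree) (ht' : t'.IsTree) (h : t.Iso t')
    (π : List (NodeLabel L)) (s : String) :
    (t'.textNodes π s).ncard = (t.textNodes π s).ncard := by
  obtain ⟨h, hb, hr, he, hl, hv⟩ := h
  rw [← Set.InjOn.ncard_image (hb.injOn.mono fun x (hx : x ∈ t.textNodes π s) => hx.1.mem ht)]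
  congr 1
  ext y
  constructor
  · rintro ⟨hy, hs⟩
    obtain ⟨x, rfl, hx⟩ := HasPath.exists_of_map ht ht' hb hr he hl hy
    exact ⟨x, ⟨hx, (hv x (hx.mem ht) hx.label).trans hs⟩, rfl⟩
  · rintro ⟨x, ⟨hx, hs⟩, rfl⟩
    exact ⟨HasPath.map ht hr he hl hx, (hv x (hx.mem ht) hx.label).symm.trans hs⟩

end Iso

end TreeData

/-! ### Label paths under atomic updates -/

namespace Step

variable {A : L} {o : UATOp L} {c : ℕ}

theorem hasPath_iff (h : Step D t t' A o c) (ht : t.IsTree) {π : List (NodeLabel L)} {x : ℕ}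
    (hx : x ∈ t.nodes) (hx' : x ∈ t'.nodes) : HasPath t' π x ↔ HasPath t π x := by
  constructor
  · intro hp
    clear hx'
    induction hp with
    | root =>
      rw [h.label_old _ hx h.isTree'.root_mem, h.root_eq]
      exact HasPath.root
    | child _ hxy ih =>
      have hy' := (h.isTree'.edge_mem _ _ hxy).2
      have hxy' := (h.edge_old _ _ hx hy').1 hxy
      rw [h.label_old _ hx hy']
      exact (ih (ht.edge_mem _ _ hxy').1).child hxy'
  · intro hp
    clear hx
    induction hp with
    | root =>
      rw [← h.label_old _ ht.root_mem hx', ← h.root_eq]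
      exact HasPath.root
    | child _ hxy ih =>
      have hy := (ht.edge_mem _ _ hxy).2
      have hxy' := (h.edge_old _ _ hy hx').2 hxy
      rw [← h.label_old _ hy hx']
      exact (ih (h.isTree'.edge_mem _ _ hxy').1).child hxy'

/-- An update only affects nodes that are deeper than the node at which it acts. -/
theorem pathNodes_eq_of_length_le (h : Step D t t' A o c) (ht : t.IsTree)
    {π σ : List (NodeLabel L)} (hc : HasPath t π c) (hσ : σ.length ≤ π.length) :
    t'.pathNodes σ = t.pathNodes σ := by
  ext x
  constructor
  · intro hx
    have hxm := HasPath.mem h.isTree' hx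
    by_cases hxt : x ∈ t.nodes
    · exact (h.hasPath_iff ht hxt hxm).1 hx
    · have := ((h.hasPath_iff ht h.mem h.mem').2 hc).length_lt h.isTree' (h.new_desc x hxm hxt) hx
      omega
  · intro hx
    have hxm := HasPath.mem ht hx
    by_cases hxt : x ∈ t'.nodes
    · exact (h.hasPath_iff ht hxm hxt).2 hx
    · have := hc.length_lt ht (h.old_desc x hxm hxt) hx
      omega

/-- An update acting at or below a child of the nodes with label path `σ` does not affect them. -/
theorem pathNodesTo_eq_of_length_lt (h : Step D t t' A o c) (ht : t.IsTree)
    {π σ : List (NodeLabel L)} (hc : HasPath t π c) (hσ : σ.length < π.length) (U : Set L) :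
    t'.pathNodesTo σ U = t.pathNodesTo σ U := by
  have key : ∀ l y, HasPath t' (l :: σ) y ↔ HasPath t (l :: σ) y := fun l =>
    Set.ext_iff.1 (h.pathNodes_eq_of_length_le ht hc (σ := l :: σ) hσ)
  have hx := fun x => Set.ext_iff.1 (h.pathNodes_eq_of_length_le ht hc hσ.le) x
  ext x
  constructor
  · rintro ⟨hxp, y, hy, B, hB, hyB⟩
    have hyp := (key _ y).1 (hxp.child hy)
    have hm := hyp.mem ht
    have hm' := (h.isTree'.edge_mem _ _ hy).2
    exact ⟨(hx x).1 hxp, y, (h.edge_old _ _ hm hm').1 hy, B, hB,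
      (h.label_old y hm hm').symm.trans hyB⟩
  · rintro ⟨hxp, y, hy, B, hB, hyB⟩
    have hyp := (key _ y).2 (hxp.child hy)
    have hm := (ht.edge_mem _ _ hy).2
    have hm' := hyp.mem h.isTree'
    exact ⟨(hx x).2 hxp, y, (h.edge_old _ _ hm hm').2 hy, B, hB, (h.label_old y hm hm').trans hyB⟩

end Step

/-- A weakly increasing chain of finite sets is constant if its last set is not larger than its
first one. -/
theorem eq_of_chain {α : Type*} {X : ℕ → Set α} {k : ℕ} (hfin : (X k).Finite)
    (hmono : ∀ j < k, X j ⊆ X (j + 1)) (hcard : (X k).ncard ≤ (X 0).ncard) :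
    ∀ j < k, X (j + 1) = X j := by
  have hle : ∀ i j, i ≤ j → j ≤ k → X i ⊆ X j := by
    intro i j hij
    induction j, hij using Nat.le_induction with
    | base => exact fun _ => subset_rfl
    | succ j _ ih => exact fun hj => (ih (by omega)).trans (hmono j (by omega))
  have h0 : X 0 = X k := Set.eq_of_subset_of_ncard_le (hle 0 k (by omega) le_rfl) hcard hfin
  intro j hj
  exact ((hle (j + 1) k hj le_rfl).trans (h0 ▸ hle 0 j (by omega) hj.le)).antisymm (hmono j hj)

theorem eq_of_chain_anti {α : Type*} {X : ℕ → Set α} {k : ℕ} (hfin : (X 0).Finite)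
    (hanti : ∀ j < k, X (j + 1) ⊆ X j) (hcard : (X 0).ncard ≤ (X k).ncard) :
    ∀ j < k, X (j + 1) = X j := by
  have hle : ∀ i j, i ≤ j → j ≤ k → X j ⊆ X i := by
    intro i j hij
    induction j, hij using Nat.le_induction with
    | base => exact fun _ => subset_rfl
    | succ j _ ih => exact fun hj => (hanti j (by omega)).trans (ih (by omega))
  have h0 : X k = X 0 := Set.eq_of_subset_of_ncard_le (hle 0 k (by omega) le_rfl) hcard hfin
  intro j hj
  exact (hanti j hj).antisymm ((hle 0 j (by omega) hj.le).trans (h0 ▸ hle (j + 1) k hj le_rfl))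

/-! ### Closure properties of the operator `T` -/

namespace DTD

variable {S : Set (UAT L)} {A B B' : L} {o : UATOp L}

/-- Every valid update access type at an element type below `A` belongs to `T(S)`. -/
def Free (D : DTD L) (S : Set (UAT L)) (A : L) : Prop :=
  ∀ uat ∈ D.valid, D.Le A uat.1 → uat ∈ D.T S

theorem Free.of_le (h : D.Free S A) (hAB : D.Le A B) : D.Free S B :=
  fun uat hv hle => h uat hv (hAB.trans hle)

theorem subset_T (D : DTD L) (S : Set (UAT L)) : S ⊆ D.T S :=
  fun _ h => Or.inl (Or.inl (Or.inl h))

theorem T_subset_valid (hS : S ⊆ D.valid) : D.T S ⊆ D.valid := by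
  rintro uat (((h | h) | h) | h)
  · exact hS h
  · exact h.1
  · exact h.1
  · exact h.1

theorem T_empty (D : DTD L) : D.T ∅ = ∅ := by
  have hplus : ∀ A B B', ¬ ReplaceEdgePlus (∅ : Set (UAT L)) A B B' := by
    intro A B B' h
    obtain ⟨_, h, -⟩ := TransGen.head'_iff.1 h
    exact h
  refine Set.eq_empty_of_forall_notMem ?_
  rintro uat (((h | h) | h) | h)
  · exact h
  · obtain ⟨-, A, -, B, -, h, -⟩ := h
    exact h
  · obtain ⟨-, A, -, Bs, -, B, -, h, -⟩ := h
    exact hplus _ _ _ h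
  · obtain ⟨-, A, -, Bs, -, B, -, B', -, h, -⟩ := h
    exact hplus _ _ _ h

/-- A member of `T(S)` belongs to `S`, or is a replacement along a path of `𝒢_A(S)`, or is there
because everything at its type is. -/
theorem mem_T_cases (h : (A, o) ∈ D.T S) : (A, o) ∈ S ∨ D.Free S A ∨
    ∃ B B', o = UATOp.replace B B' ∧ ReplaceEdgePlus S A B B' := by
  rcases h with ((h | h) | h) | h
  · exact Or.inl h
  · obtain ⟨-, A', hA', B, hR, hi, hd, hle⟩ := h
    exact Or.inr (Or.inl fun uat hv hle' => Or.inl (Or.inl (Or.inr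
      ⟨hv, A', hA', B, hR, hi, hd, hle.trans hle'⟩)))
  · obtain ⟨-, A', hA', Bs, hR, B, hB, hp, hle⟩ := h
    exact Or.inr (Or.inl fun uat hv hle' => Or.inl (Or.inr
      ⟨hv, A', hA', Bs, hR, B, hB, hp, hle.trans hle'⟩))
  · obtain ⟨-, A', hA', Bs, hR, B, hB, B', hB', hp, e⟩ := h
    cases e
    exact Or.inr (Or.inr ⟨B, B', rfl, hp⟩)

theorem sub_star (hA : A ∈ D.Ele) (hR : D.Rg A = ContentModel.star B) : D.Sub A B :=
  ⟨hA, by rw [hR]; exact List.mem_singleton_self B⟩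

theorem sub_alt {Bs : List L} (hA : A ∈ D.Ele) (hR : D.Rg A = ContentModel.alt Bs)
    (hB : B ∈ Bs) : D.Sub A B :=
  ⟨hA, by rw [hR]; exact hB⟩

theorem free_of_star (hA : A ∈ D.Ele) (hR : D.Rg A = ContentModel.star B)
    (hi : (A, UATOp.insert B) ∈ D.T S) (hd : (A, UATOp.delete B) ∈ D.T S) : D.Free S B := by
  rcases mem_T_cases hi with hi | hi | ⟨_, _, e, -⟩
  · rcases mem_T_cases hd with hd | hd | ⟨_, _, e, -⟩
    · exact fun uat hv hle => Or.inl (Or.inl (Or.inr ⟨hv, A, hA, B, hR, hi, hd, hle⟩))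
    · exact hd.of_le (ReflTransGen.single (sub_star hA hR))
    · cases e
  · exact hi.of_le (ReflTransGen.single (sub_star hA hR))
  · cases e

/-- Unless `T(S)` allows everything at `A`, the graphs `𝒢_A⁺(T(S))` and `𝒢_A⁺(S)` agree. -/
theorem replaceEdgePlus_of_T (h : ReplaceEdgePlus (D.T S) A B B') :
    D.Free S A ∨ ReplaceEdgePlus S A B B' := by
  have edge : ∀ {X Y}, ReplaceEdge (D.T S) A X Y → D.Free S A ∨ ReplaceEdgePlus S A X Y := by
    intro X Y h
    rcases mem_T_cases h with h | h | ⟨_, _, e, hp⟩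
    · exact Or.inr (TransGen.single h)
    · exact Or.inl h
    · cases e
      exact Or.inr hp
  induction h with
  | single h => exact edge h
  | tail _ h ih =>
    rcases ih with ih | ih
    · exact Or.inl ih
    · exact (edge h).imp_right fun h => TransGen.trans ih h

theorem free_of_cycle {Bs : List L} (hA : A ∈ D.Ele) (hR : D.Rg A = ContentModel.alt Bs)
    (hB : B ∈ Bs) (h : ReplaceEdgePlus (D.T S) A B B) : D.Free S B := by
  rcases replaceEdgePlus_of_T h with h | h
  · exact h.of_le (ReflTransGen.single (sub_alt hA hR hB))
  · exact fun uat hv hle => Or.inl (Or.inr ⟨hv, A, hA, Bs, hR, B, hB, h, hle⟩)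

theorem replace_mem_T {Bs : List L} (hA : A ∈ D.Ele) (hR : D.Rg A = ContentModel.alt Bs)
    (hB : B ∈ Bs) (hB' : B' ∈ Bs) (hne : B ≠ B') (h : ReplaceEdgePlus (D.T S) A B B') :
    (A, UATOp.replace B B') ∈ D.T S := by
  have hv : (A, UATOp.replace B B') ∈ D.valid := IsValidUAT.replace hA hR hB hB' hne
  rcases replaceEdgePlus_of_T h with h | h
  · exact h _ hv ReflTransGen.refl
  · exact Or.inr ⟨hv, A, hA, Bs, hR, B, hB, B', hB', h, rfl⟩

theorem rg_of_insert_mem_valid (h : (A, UATOp.insert B) ∈ D.valid) :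
    D.Rg A = ContentModel.star B := by
  cases h; assumption

theorem rg_of_delete_mem_valid (h : (A, UATOp.delete B) ∈ D.valid) :
    D.Rg A = ContentModel.star B := by
  cases h; assumption

theorem rg_of_replace_mem_valid (h : (A, UATOp.replace B B') ∈ D.valid) :
    ∃ Bs, D.Rg A = ContentModel.alt Bs ∧ A ∈ D.Ele ∧ B ∈ Bs ∧ B' ∈ Bs ∧ B ≠ B' := by
  cases h; exact ⟨_, ‹_›, ‹_›, ‹_›, ‹_›, ‹_›⟩

end DTD

open DTD

/-! ### Monotonicity of an update at the nodes with a given label path -/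

namespace Step

variable {A X : L} {o : UATOp L} {c : ℕ} {l : NodeLabel L} {σ : List (NodeLabel L)}

/-- If the nodes with label path `elem X :: σ` persist, a child of such a node can only disappear
because it is itself deleted or replaced. -/
theorem lost (h : Step D t t' A o c) (ht : t.IsTree)
    (hσ : t'.pathNodes (NodeLabel.elem X :: σ) = t.pathNodes (NodeLabel.elem X :: σ)) {y : ℕ}
    (hy : HasPath t (l :: NodeLabel.elem X :: σ) y)
    (hy' : ¬ HasPath t' (l :: NodeLabel.elem X :: σ) y) :
    A = X ∧ t.edge c y ∧ HasPath t (NodeLabel.elem X :: σ) c ∧ ∃ B, l = NodeLabel.elem B ∧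
      (o = UATOp.delete B ∨ ∃ B', o = UATOp.replace B B' ∧ B ≠ B') := by
  obtain ⟨x, hx, hxy⟩ := hy.exists_parent (by simp)
  have hx' : HasPath t' (NodeLabel.elem X :: σ) x := (Set.ext_iff.1 hσ x).2 hx
  have hyt : y ∉ t'.nodes := fun hm => hy' ((h.hasPath_iff ht (hy.mem ht) hm).2 hy)
  obtain ⟨rfl, B, hB, hop⟩ := h.old_child x y hxy (hx'.mem h.isTree') hyt
  have e := h.label_c.symm.trans hx.label
  cases e
  exact ⟨rfl, hxy, hx, B, hy.label.symm.trans hB, hop⟩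

/-- If the nodes with label path `elem X :: σ` persist, a child of such a node can only appear
because it is itself inserted or replaces another one. -/
theorem gained (h : Step D t t' A o c) (ht : t.IsTree)
    (hσ : t'.pathNodes (NodeLabel.elem X :: σ) = t.pathNodes (NodeLabel.elem X :: σ)) {y : ℕ}
    (hy : ¬ HasPath t (l :: NodeLabel.elem X :: σ) y)
    (hy' : HasPath t' (l :: NodeLabel.elem X :: σ) y) :
    A = X ∧ t'.edge c y ∧ HasPath t (NodeLabel.elem X :: σ) c ∧ ∃ B', l = NodeLabel.elem B' ∧
      (o = UATOp.insert B' ∨ ∃ B, o = UATOp.replace B B' ∧ B ≠ B') := by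
  obtain ⟨x, hx', hxy⟩ := hy'.exists_parent (by simp)
  have hx : HasPath t (NodeLabel.elem X :: σ) x := (Set.ext_iff.1 hσ x).1 hx'
  have hyt : y ∉ t.nodes := fun hm => hy ((h.hasPath_iff ht hm (hy'.mem h.isTree')).1 hy')
  obtain ⟨rfl, B, hB, hop⟩ := h.new_child x y hxy (hx.mem ht) hyt
  have e := h.label_c.symm.trans hx.label
  cases e
  exact ⟨rfl, hxy, hx, B, hy'.label.symm.trans hB, hop⟩

/-- If an update cannot delete children below `B*`, their set can only grow. -/
theorem subset_of_star (h : Step D t t' A o c) (ht : t.IsTree) (hv : (A, o) ∈ D.valid) {B : L}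
    (hR : D.Rg X = ContentModel.star B) (hdel : (A, o) ≠ (X, UATOp.delete B))
    (hσ : t'.pathNodes (NodeLabel.elem X :: σ) = t.pathNodes (NodeLabel.elem X :: σ)) :
    t.pathNodes (NodeLabel.elem B :: NodeLabel.elem X :: σ) ⊆
      t'.pathNodes (NodeLabel.elem B :: NodeLabel.elem X :: σ) := by
  intro y hy
  by_contra hy'
  obtain ⟨rfl, -, -, B₁, e, rfl | ⟨_, rfl, -⟩⟩ := h.lost ht hσ hy hy'
  · cases e
    exact hdel rfl
  · obtain ⟨_, hR', -⟩ := rg_of_replace_mem_valid hv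
    cases hR.symm.trans hR'

/-- If an update cannot insert children below `B*`, their set can only shrink. -/
theorem subset_of_star' (h : Step D t t' A o c) (ht : t.IsTree) (hv : (A, o) ∈ D.valid) {B : L}
    (hR : D.Rg X = ContentModel.star B) (hins : (A, o) ≠ (X, UATOp.insert B))
    (hσ : t'.pathNodes (NodeLabel.elem X :: σ) = t.pathNodes (NodeLabel.elem X :: σ)) :
    t'.pathNodes (NodeLabel.elem B :: NodeLabel.elem X :: σ) ⊆
      t.pathNodes (NodeLabel.elem B :: NodeLabel.elem X :: σ) := by
  intro y hy
  by_contra hy'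
  obtain ⟨rfl, -, -, B₁, e, rfl | ⟨_, rfl, -⟩⟩ := h.gained ht hσ hy' hy
  · cases e
    exact hins rfl
  · obtain ⟨_, hR', -⟩ := rg_of_replace_mem_valid hv
    cases hR.symm.trans hR'

/-- If a set `U` of types is closed under the replacements at `X`, the set of the `X`-nodes whose
child has its type in `U` can only grow. -/
theorem pathNodesTo_subset (h : Step D t t' A o c) (ht : t.IsTree) (hv : (A, o) ∈ D.valid)
    {Bs : List L} (hR : D.Rg X = ContentModel.alt Bs) {U : Set L}
    (hU : ∀ B B', (A, o) = (X, UATOp.replace B B') → B ∈ U → B' ∈ U)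
    (hσ : t'.pathNodes (NodeLabel.elem X :: σ) = t.pathNodes (NodeLabel.elem X :: σ)) :
    t.pathNodesTo (NodeLabel.elem X :: σ) U ⊆ t'.pathNodesTo (NodeLabel.elem X :: σ) U := by
  rintro x ⟨hx, y, hxy, B, hB, hyB⟩
  have hx' : HasPath t' (NodeLabel.elem X :: σ) x := (Set.ext_iff.1 hσ x).2 hx
  refine ⟨hx', ?_⟩
  have hy := (ht.edge_mem _ _ hxy).2
  by_cases hy' : y ∈ t'.nodes
  · exact ⟨y, (h.edge_old _ _ hy hy').2 hxy, B, hB, (h.label_old y hy hy').trans hyB⟩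
  · obtain ⟨rfl, B₁, e, hop⟩ := h.old_child x y hxy (hx'.mem h.isTree') hy'
    cases hyB.symm.trans e
    cases h.label_c.symm.trans hx.label
    rcases hop with rfl | ⟨B', rfl, -⟩
    · cases hR.symm.trans (rg_of_delete_mem_valid hv)
    · obtain ⟨m, hm, hml, -⟩ := h.gains B' (Or.inr ⟨_, rfl⟩)
      exact ⟨m, hm, B', hU _ _ rfl hB, hml⟩

end Step

theorem TreeData.ConformsAt.le_of_reach {R X A : L} (ht : t.ConformsAt D R) {x c : ℕ}
    (h : ReflTransGen t.edge x c) (hxl : t.label x = NodeLabel.elem X)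
    (hcl : t.label c = NodeLabel.elem A) : D.Le X A := by
  induction h generalizing A with
  | refl =>
    cases hxl.symm.trans hcl
    exact ReflTransGen.refl
  | tail _ hyc ih =>
    obtain ⟨Y, hY⟩ := ht.exists_elem_of_edge hyc
    rcases ht.child_label (ht.isTree.edge_mem _ _ hyc).1 hY hyc with ⟨B, hB, hs⟩ | ⟨-, hs⟩
    · cases hcl.symm.trans hB
      exact (ih hY).tail hs
    · cases hcl.symm.trans hs

/-! ### Updates outside `T(S)` cannot be simulated by updates in `T(S)` -/

section Simulation

variable {S : Set (UAT L)} {R : L} {f : ℕ → TreeData L} {k : ℕ} {A : L} {o : UATOp L} {c : ℕ}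

/-- Let `f 0, …, f k` be the trees obtained by successive updates in `T(S)`, and let `f k` be
isomorphic to the result `t'` of an update at a node `c` of `f 0`. Unless `T(S)` allows all updates
at the type of `c`, none of the successive updates creates or destroys a node whose label path is
that of `c` or of an ancestor of `c`. -/
theorem pathNodes_frozen (hS : S ⊆ D.valid) (hconf : ∀ j ≤ k, (f j).ConformsAt D R)
    (hstep : ∀ j < k, ∃ A o c, (A, o) ∈ D.T S ∧ Step D (f j) (f (j + 1)) A o c)
    (h0 : Step D (f 0) t' A o c) (hiso : (f k).Iso t') (hfree : ¬ D.Free S A)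
    {σ : List (NodeLabel L)} {x : ℕ} (hx : HasPath (f 0) σ x)
    (hxc : ReflTransGen (f 0).edge x c) :
    ∀ j < k, (f (j + 1)).pathNodes σ = (f j).pathNodes σ := by
  have hc0 := hconf 0 (by omega)
  have ht0 := hc0.isTree
  have hTv := T_subset_valid hS
  obtain ⟨π, hπ⟩ := ht0.exists_hasPath h0.mem
  induction hx with
  | root =>
    intro j hj
    obtain ⟨A, o, c, -, h⟩ := hstep j hj
    ext y
    show HasPath _ _ _ ↔ HasPath _ _ _
    rw [hasPath_singleton, hasPath_singleton, h.root_eq, h.label_old _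
      (hconf j hj.le).isTree.root_mem (h.root_eq ▸ h.isTree'.root_mem)]
  | @child σ x y hx hxy ih =>
    specialize ih (ReflTransGen.head hxy hxc)
    obtain ⟨X, hX⟩ := hc0.exists_elem_of_edge hxy
    have hxm := (ht0.edge_mem _ _ hxy).1
    obtain ⟨B, hB⟩ : ∃ B, (f 0).label y = NodeLabel.elem B := by
      rcases ReflTransGen.cases_head hxc with rfl | ⟨z, hz, -⟩
      · exact ⟨A, h0.label_c⟩
      · exact hc0.exists_elem_of_edge hz
    have hBfree : ¬ D.Free S B := fun h => hfree (h.of_le (hc0.le_of_reach hxc hB h0.label_c))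
    have hsub : D.Sub X B := by
      rcases hc0.child_label hxm hX hxy with ⟨B', hB', hs⟩ | ⟨-, hs⟩
      · cases hB.symm.trans hB'
        exact hs
      · cases hB.symm.trans hs
    obtain ⟨σ, rfl⟩ : ∃ σ', σ = NodeLabel.elem X :: σ' := by
      cases σ with
      | nil => exact absurd rfl hx.ne_nil
      | cons l σ' => exact ⟨σ', by rw [← hx.label, hX]⟩
    have hlen := (hx.child hxy).length_le ht0 hxc hπ
    have hcard : ((f k).pathNodes ((f 0).label y :: NodeLabel.elem X :: σ)).ncard =
        ((f 0).pathNodes ((f 0).label y :: NodeLabel.elem X :: σ)).ncard := by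
      rw [← h0.pathNodes_eq_of_length_le ht0 hπ hlen,
        hiso.ncard_pathNodes (hconf k le_rfl).isTree h0.isTree']
    have hcardTo : ∀ U, ((f k).pathNodesTo (NodeLabel.elem X :: σ) U).ncard =
        ((f 0).pathNodesTo (NodeLabel.elem X :: σ) U).ncard := by
      intro U
      rw [← h0.pathNodesTo_eq_of_length_lt ht0 hπ hlen,
        hiso.ncard_pathNodesTo (hconf k le_rfl).isTree h0.isTree']
    rw [hB] at hcard ⊢
    obtain ⟨hXE, hBX⟩ := hsub
    cases hR : D.Rg X with
    | str => rw [hR] at hBX; simp [ContentModel.types] at hBX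
    | eps => rw [hR] at hBX; simp [ContentModel.types] at hBX
    | seq Bs =>
      intro j hj
      obtain ⟨A', o', c', hT, h⟩ := hstep j hj
      have hv := hTv hT
      have ht := (hconf j hj.le).isTree
      ext z
      constructor <;> intro hz <;> by_contra hz'
      · obtain ⟨rfl, -, -, _, -, rfl | ⟨_, rfl, -⟩⟩ := h.gained ht (ih j hj) hz' hz
        · cases hR.symm.trans (rg_of_insert_mem_valid hv)
        · obtain ⟨_, hR', -⟩ := rg_of_replace_mem_valid hv
          cases hR.symm.trans hR'
      · obtain ⟨rfl, -, -, _, -, rfl | ⟨_, rfl, -⟩⟩ := h.lost ht (ih j hj) hz hz'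
        · cases hR.symm.trans (rg_of_delete_mem_valid hv)
        · obtain ⟨_, hR', -⟩ := rg_of_replace_mem_valid hv
          cases hR.symm.trans hR'
    | star B₁ =>
      obtain rfl : B = B₁ := by rw [hR] at hBX; simpa [ContentModel.types] using hBX
      by_cases hdel : (X, UATOp.delete B) ∈ D.T S
      · have hins : (X, UATOp.insert B) ∉ D.T S := fun hins =>
          hBfree (free_of_star hXE hR hins hdel)
        refine eq_of_chain_anti (X := fun j => (f j).pathNodes _) (ht0.finite_pathNodes _)
          (fun j hj => ?_) hcard.ge
        obtain ⟨A', o', c', hT, h⟩ := hstep j hj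
        exact h.subset_of_star' (hconf j hj.le).isTree (hTv hT) hR
          (fun e => hins (e ▸ hT)) (ih j hj)
      · refine eq_of_chain (X := fun j => (f j).pathNodes _)
          ((hconf k le_rfl).isTree.finite_pathNodes _) (fun j hj => ?_) hcard.le
        obtain ⟨A', o', c', hT, h⟩ := hstep j hj
        exact h.subset_of_star (hconf j hj.le).isTree (hTv hT) hR (fun e => hdel (e ▸ hT)) (ih j hj)
    | alt Bs =>
      have hBBs : B ∈ Bs := by rw [hR] at hBX; exact hBX
      have hcyc : ¬ ReplaceEdgePlus (D.T S) X B B := fun h => hBfree (free_of_cycle hXE hR hBBs h)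
      have hchain : ∀ U : Set L, (∀ Y Z, ReplaceEdge (D.T S) X Y Z → Y ∈ U → Z ∈ U) → ∀ j < k,
          (f (j + 1)).pathNodesTo (NodeLabel.elem X :: σ) U =
            (f j).pathNodesTo (NodeLabel.elem X :: σ) U := by
        intro U hU
        refine eq_of_chain (X := fun j => (f j).pathNodesTo _ U)
          ((hconf k le_rfl).isTree.finite_pathNodesTo _ _) (fun j hj => ?_) (hcardTo U).le
        obtain ⟨A', o', c', hT, h⟩ := hstep j hj
        exact h.pathNodesTo_subset (hconf j hj.le).isTree (hTv hT) hR
          (fun Y Z e => hU Y Z (show (X, _) ∈ _ from e ▸ hT)) (ih j hj)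
      -- apply this to the set of the types reachable from `B`, with and without `B` itself
      have hU := hchain {Z | ReflTransGen (ReplaceEdge (D.T S) X) B Z} fun Y Z h hY => hY.tail h
      have hU' := hchain {Z | TransGen (ReplaceEdge (D.T S) X) B Z} fun Y Z h hY => hY.tail h
      intro j hj
      obtain ⟨A', o', c', hT, h⟩ := hstep j hj
      have hv := hTv hT
      have hcj := hconf j hj.le
      ext z
      constructor <;> intro hz <;> by_contra hz'
      · obtain ⟨rfl, hcz, hcp, B₁, e, rfl | ⟨Y, rfl, -⟩⟩ := h.gained hcj.isTree (ih j hj) hz' hz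
        · cases hR.symm.trans (rg_of_insert_mem_valid hv)
        cases e
        -- the replaced child has its type `Y` in `U`, so that `B` lies on the cycle through `Y`
        have hm : c' ∈ (f (j + 1)).pathNodesTo (NodeLabel.elem A' :: σ)
            {Z | ReflTransGen (ReplaceEdge (D.T S) A') B Z} :=
          ⟨(Set.ext_iff.1 (ih j hj) _).2 hcp, z, hcz, B, ReflTransGen.refl, HasPath.label hz⟩
        rw [hU j hj] at hm
        obtain ⟨-, w, hcw, Z, hZ, hwZ⟩ := hm
        obtain ⟨n, hcn, hn, -⟩ := h.loses Y (Or.inr ⟨B, rfl⟩)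
        obtain rfl := hcj.alt_child h.mem h.label_c hR hcw hcn
        cases hwZ.symm.trans hn
        exact hcyc (TransGen.tail' hZ hT)
      · obtain ⟨rfl, hcz, hcp, B₁, e, rfl | ⟨Y, rfl, -⟩⟩ := h.lost hcj.isTree (ih j hj) hz hz'
        · cases hR.symm.trans (rg_of_delete_mem_valid hv)
        cases e
        -- after the replacement, the type of the child is in `U` but different from `B`
        obtain ⟨m, hcm, hm, -⟩ := h.gains Y (Or.inr ⟨B, rfl⟩)
        have hm : c' ∈ (f (j + 1)).pathNodesTo (NodeLabel.elem A' :: σ)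
            {Z | TransGen (ReplaceEdge (D.T S) A') B Z} :=
          ⟨(Set.ext_iff.1 (ih j hj) _).2 hcp, m, hcm, Y, TransGen.single hT, hm⟩
        rw [hU' j hj] at hm
        obtain ⟨-, w, hcw, Z, hZ, hwZ⟩ := hm
        obtain rfl := hcj.alt_child h.mem h.label_c hR hcw hcz
        cases hwZ.symm.trans (HasPath.label hz)
        exact hcyc hZ

theorem subset_of_chain {α : Type*} {X : ℕ → Set α} (h : ∀ j < k, X j ⊆ X (j + 1)) :
    X 0 ⊆ X k := by
  induction k with
  | zero => exact subset_rfl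
  | succ k ih => exact (ih fun j hj => h j (by omega)).trans (h k (by omega))

theorem subset_of_chain_anti {α : Type*} {X : ℕ → Set α} (h : ∀ j < k, X (j + 1) ⊆ X j) :
    X k ⊆ X 0 := by
  induction k with
  | zero => exact subset_rfl
  | succ k ih => exact (h k (by omega)).trans (ih fun j hj => h j (by omega))

/-- An update whose type is valid but does not belong to `T(S)` cannot be simulated by updates in
`T(S)`. By `pathNodes_frozen` the nodes that share the label path of the node `c` where it acts
persist; the number of their children of a given type, of those of them with a child of a type
reachable from a given one, or of their text children with a given value is then compared. -/
theorem not_iso_of_notMem_T (hS : S ⊆ D.valid) (hconf : ∀ j ≤ k, (f j).ConformsAt D R)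
    (hstep : ∀ j < k, ∃ A o c, (A, o) ∈ D.T S ∧ Step D (f j) (f (j + 1)) A o c)
    (h0 : Step D (f 0) t' A o c) (hv : (A, o) ∈ D.valid) (hnT : (A, o) ∉ D.T S)
    (hne : t' ≠ f 0) : ¬ (f k).Iso t' := by
  intro hiso
  have hc0 := hconf 0 (by omega)
  have ht0 := hc0.isTree
  have htk := (hconf k le_rfl).isTree
  have ht' := h0.isTree'
  have hTv := T_subset_valid hS
  obtain ⟨π, hπ⟩ := ht0.exists_hasPath h0.mem
  have hfr := pathNodes_frozen hS hconf hstep h0 hiso (fun h => hnT (h _ hv ReflTransGen.refl)) hπ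
    ReflTransGen.refl
  have hfr0 := h0.pathNodes_eq_of_length_le ht0 hπ le_rfl
  obtain ⟨σ, rfl⟩ : ∃ σ', π = NodeLabel.elem A :: σ' := by
    cases π with
    | nil => exact absurd rfl hπ.ne_nil
    | cons l σ' => exact ⟨σ', by rw [← hπ.label, h0.label_c]⟩
  have hπ' := (h0.hasPath_iff ht0 h0.mem h0.mem').2 hπ
  cases hv with
  | @insert _ B hA hR =>
    have hle : (f k).pathNodes (NodeLabel.elem B :: NodeLabel.elem A :: σ) ⊆ (f 0).pathNodes _ :=
      subset_of_chain_anti (X := fun j => (f j).pathNodes _) fun j hj => by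
        obtain ⟨A', o', c', hT, h⟩ := hstep j hj
        exact h.subset_of_star' (hconf j hj.le).isTree (hTv hT) hR
          (fun e => hnT (e ▸ hT)) (hfr j hj)
    have hlt : (f 0).pathNodes (NodeLabel.elem B :: NodeLabel.elem A :: σ) ⊂
        t'.pathNodes (NodeLabel.elem B :: NodeLabel.elem A :: σ) := by
      refine ⟨h0.subset_of_star ht0 (IsValidUAT.insert hA hR) hR (by simp) hfr0, fun hsub => ?_⟩
      obtain ⟨m, hm, hml, hmn, -⟩ := h0.gains B (Or.inl rfl)
      exact hmn (HasPath.mem ht0 (hsub (hml ▸ hπ'.child hm)))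
    have h1 := Set.ncard_le_ncard hle (ht0.finite_pathNodes _)
    have h2 := Set.ncard_lt_ncard hlt (ht'.finite_pathNodes _)
    have h3 := hiso.ncard_pathNodes htk ht' (NodeLabel.elem B :: NodeLabel.elem A :: σ)
    omega
  | @delete _ B hA hR =>
    have hle : (f 0).pathNodes (NodeLabel.elem B :: NodeLabel.elem A :: σ) ⊆ (f k).pathNodes _ :=
      subset_of_chain (X := fun j => (f j).pathNodes _) fun j hj => by
        obtain ⟨A', o', c', hT, h⟩ := hstep j hj
        exact h.subset_of_star (hconf j hj.le).isTree (hTv hT) hR (fun e => hnT (e ▸ hT)) (hfr j hj)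
    have hlt : t'.pathNodes (NodeLabel.elem B :: NodeLabel.elem A :: σ) ⊂
        (f 0).pathNodes (NodeLabel.elem B :: NodeLabel.elem A :: σ) := by
      refine ⟨h0.subset_of_star' ht0 (IsValidUAT.delete hA hR) hR (by simp) hfr0, fun hsub => ?_⟩
      obtain ⟨m, hm, hml, hmn⟩ := h0.loses B (Or.inl rfl)
      exact hmn (HasPath.mem ht' (hsub (hml ▸ hπ.child hm)))
    have h1 := Set.ncard_le_ncard hle (htk.finite_pathNodes _)
    have h2 := Set.ncard_lt_ncard hlt (ht0.finite_pathNodes _)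
    have h3 := hiso.ncard_pathNodes htk ht' (NodeLabel.elem B :: NodeLabel.elem A :: σ)
    omega
  | @replace _ B B' Bs hA hR hB hB' hBB' =>
    let U : Set L := {Z | ReflTransGen (ReplaceEdge (D.T S) A) B Z}
    have hB'U : B' ∉ U := by
      intro h
      rcases reflTransGen_iff_eq_or_transGen.1 h with e | h
      · exact hBB' e.symm
      · exact hnT (replace_mem_T hA hR hB hB' hBB' h)
    have hle : (f 0).pathNodesTo (NodeLabel.elem A :: σ) U ⊆ (f k).pathNodesTo _ U :=
      subset_of_chain (X := fun j => (f j).pathNodesTo _ U) fun j hj => by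
        obtain ⟨A', o', c', hT, h⟩ := hstep j hj
        exact h.pathNodesTo_subset (hconf j hj.le).isTree (hTv hT) hR
          (fun Y Z e (hY : ReflTransGen _ B Y) =>
            hY.tail (show (A, _) ∈ D.T S from e ▸ hT)) (hfr j hj)
    have hlt : t'.pathNodesTo (NodeLabel.elem A :: σ) U ⊂
        (f 0).pathNodesTo (NodeLabel.elem A :: σ) U := by
      have hold : ∀ x y Z, t'.edge x y → HasPath (f 0) (NodeLabel.elem A :: σ) x → Z ∈ U →
          t'.label y = NodeLabel.elem Z → y ∈ (f 0).nodes := by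
        intro x y Z hxy hx hZ hy
        by_contra hyn
        obtain ⟨-, B₁, hB₁, e | ⟨_, e, -⟩⟩ := h0.new_child x y hxy (hx.mem ht0) hyn <;> cases e
        cases hy.symm.trans hB₁
        exact hB'U hZ
      obtain ⟨n, hn, hnl, hnn⟩ := h0.loses B (Or.inr ⟨B', rfl⟩)
      refine ⟨?_, fun hsub => ?_⟩
      · rintro x ⟨hx', y, hxy, Z, hZ, hy⟩
        have hx := (Set.ext_iff.1 hfr0 x).1 hx'
        have hyt := hold x y Z hxy hx hZ hy
        have hyt' := (ht'.edge_mem _ _ hxy).2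
        exact ⟨hx, y, (h0.edge_old _ _ hyt hyt').1 hxy, Z, hZ,
          (h0.label_old y hyt hyt').symm.trans hy⟩
      · obtain ⟨-, y, hcy, Z, hZ, hy⟩ := hsub ⟨hπ, n, hn, B, ReflTransGen.refl, hnl⟩
        have hyt := hold c y Z hcy hπ hZ hy
        have hyt' := (ht'.edge_mem _ _ hcy).2
        obtain rfl := hc0.alt_child h0.mem h0.label_c hR ((h0.edge_old _ _ hyt hyt').1 hcy) hn
        exact hnn hyt'
    have h1 := Set.ncard_le_ncard hle (htk.finite_pathNodesTo _ _)
    have h2 := Set.ncard_lt_ncard hlt (ht0.finite_pathNodesTo _ _)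
    have h3 := hiso.ncard_pathNodesTo htk ht' (NodeLabel.elem A :: σ) U
    omega
  | @replaceText _ hA hR =>
    obtain ⟨n, s, hn, hnl, rfl⟩ := h0.text rfl
    have hs : s ≠ (f 0).val n := by
      rintro rfl
      exact hne (by rw [Function.update_eq_self])
    have hle : (f 0).textNodes (NodeLabel.elem A :: σ) ((f 0).val n) ⊆
        (f k).textNodes (NodeLabel.elem A :: σ) ((f 0).val n) := by
      refine subset_of_chain (X := fun j => (f j).textNodes _ _) fun j hj => ?_
      obtain ⟨A', o', c', hT, h⟩ := hstep j hj
      have ht := (hconf j hj.le).isTree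
      rintro y ⟨hy, hyv⟩
      have hy' : HasPath (f (j + 1)) (NodeLabel.str :: NodeLabel.elem A :: σ) y := by
        by_contra hy'
        obtain ⟨-, -, -, _, e, -⟩ := h.lost ht (hfr j hj) hy hy'
        cases e
      refine ⟨hy', ?_⟩
      rcases h.val_old y (hy.mem ht) (hy'.mem h.isTree') with e | ⟨rfl, hc'⟩
      · rw [e, hyv]
      · obtain ⟨p, hp, hpy⟩ := hy.exists_parent (by simp)
        obtain rfl := ht.parent_unique _ _ _ hc' hpy
        cases h.label_c.symm.trans hp.label
        exact absurd hT hnT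
    have hlt : TreeData.textNodes { f 0 with val := Function.update (f 0).val n s }
        (NodeLabel.elem A :: σ) ((f 0).val n) ⊂
        (f 0).textNodes (NodeLabel.elem A :: σ) ((f 0).val n) := by
      refine ⟨?_, fun hsub => ?_⟩
      · rintro y ⟨hy, hyv⟩
        have hym := hy.mem ht'
        refine ⟨(h0.hasPath_iff ht0 hym hym).1 hy, ?_⟩
        by_cases hyn : y = n
        · rw [hyn]
        · rw [← hyv]
          exact (Function.update_of_ne hyn _ _).symm
      · have := hsub (show n ∈ _ from ⟨hnl ▸ hπ.child hn, rfl⟩)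
        exact hs ((Function.update_self n s (f 0).val).symm.trans this.2)
    have h1 := Set.ncard_le_ncard hle (htk.finite_textNodes _ _)
    have h2 := Set.ncard_lt_ncard hlt (ht0.finite_textNodes _ _)
    have h3 := hiso.ncard_textNodes htk ht' (NodeLabel.elem A :: σ) ((f 0).val n)
    exact absurd (h1.trans h3.ge) (not_le.2 h2)

end Simulation

/-- The successive trees along an allowed sequence. -/
theorem AllowedSeq.exists_trees {S : Set (UAT L)} (hS : S ⊆ D.valid) {R : L}
    {ops : List (Update L)} {t : TreeData L} (ht : t.ConformsAt D R) (h : AllowedSeq D S t ops) :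
    ∃ f : ℕ → TreeData L, f 0 = t ∧ f ops.length = Update.applySeq t ops ∧
      (∀ j ≤ ops.length, (f j).ConformsAt D R) ∧
      ∀ j < ops.length, ∃ A o c, (A, o) ∈ S ∧ Step D (f j) (f (j + 1)) A o c := by
  induction ops generalizing t with
  | nil => exact ⟨fun _ => t, rfl, rfl, fun _ _ => ht, fun j hj => absurd hj (Nat.not_lt_zero j)⟩
  | cons op ops ih =>
    obtain ⟨hv, ⟨⟨A, o⟩, hAo, hm⟩, hrest⟩ := h
    obtain ⟨c, hc⟩ := hm.step ht.isTree hv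
    obtain ⟨f, hf0, hfk, hconf, hstep⟩ := ih (hc.conformsAt ht (hS hAo)) hrest
    refine ⟨fun j => Nat.casesOn j t f, rfl, hfk, ?_, ?_⟩
    · rintro (_ | j) hj
      · exact ht
      · exact hconf j (Nat.le_of_succ_le_succ hj)
    · rintro (_ | j) hj
      · exact ⟨A, o, c, hAo, by rw [← hf0] at hc; exact hc⟩
      · exact hstep j (Nat.lt_of_succ_lt_succ hj)

theorem not_iso_of_allowedSeq {S : Set (UAT L)} (hS : S ⊆ D.valid) {R : L} (ht : t.ConformsAt D R)
    {ops : List (Update L)} (hops : AllowedSeq D (D.T S) t ops) {op : Update L} (hv : op.Valid t)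
    {uat : UAT L} (hm : Matches D t op uat) (huv : uat ∈ D.valid) (huT : uat ∉ D.T S)
    (hne : Update.apply t op ≠ t) : ¬ (Update.applySeq t ops).Iso (Update.apply t op) := by
  obtain ⟨f, rfl, hfk, hconf, hstep⟩ := hops.exists_trees (T_subset_valid hS) ht
  obtain ⟨c, hc⟩ := hm.step ht.isTree hv
  rw [← hfk]
  exact not_iso_of_notMem_T hS hconf hstep hc huv huT hne

/-- An update of a valid type that changes the tree at all changes its isomorphism class. -/
theorem Matches.not_iso {R : L} (ht : t.ConformsAt D R) {op : Update L} (hv : op.Valid t)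
    {uat : UAT L} (hm : Matches D t op uat) (huv : uat ∈ D.valid)
    (hne : Update.apply t op ≠ t) : ¬ (Update.apply t op).Iso t := by
  intro h
  obtain ⟨c, hc⟩ := hm.step ht.isTree hv
  exact not_iso_of_allowedSeq (S := ∅) (Set.empty_subset _) ht (ops := []) trivial hv hm huv
    (by rw [T_empty]; exact Set.notMem_empty _) hne (h.symm hc.isTree'.root_mem)

/-! ### Existence of conforming trees -/

namespace TreeData

/-- The tree `t` with all node identifiers increased by `K`. -/
def shift (t : TreeData L) (K : ℕ) : TreeData L where
  nodes := {x | K ≤ x ∧ x - K ∈ t.nodes}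
  edge x y := K ≤ x ∧ K ≤ y ∧ t.edge (x - K) (y - K)
  label x := t.label (x - K)
  root := t.root + K
  val x := t.val (x - K)

/-- `e` maps `v` into `t`, preserving labels and edges. -/
structure Embeds (e : ℕ → ℕ) (v t : TreeData L) : Prop where
  label : ∀ x ∈ v.nodes, t.label (e x) = v.label x
  edge : ∀ x y, v.edge x y → t.edge (e x) (e y)

theorem Embeds.id (t : TreeData L) : Embeds id t t := ⟨fun _ _ => rfl, fun _ _ h => h⟩

theorem Embeds.reach {e : ℕ → ℕ} (h : Embeds e v t) {x y : ℕ}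
    (hxy : ReflTransGen v.edge x y) : ReflTransGen t.edge (e x) (e y) := by
  induction hxy with
  | refl => exact ReflTransGen.refl
  | tail _ hz ih => exact ih.tail (h.edge _ _ hz)

theorem Embeds.mem {e : ℕ → ℕ} (h : Embeds e v t) (hv : v.IsTree) (ht : t.IsTree)
    (hr : e v.root ∈ t.nodes) {x : ℕ} (hx : x ∈ v.nodes) : e x ∈ t.nodes :=
  ht.reach_of_edge hr (h.reach (hv.reachable x hx))

theorem Embeds.comp {e₁ e₂ : ℕ → ℕ} (h₂ : Embeds e₂ u t) (h₁ : Embeds e₁ v u)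
    (hm : ∀ x ∈ v.nodes, e₁ x ∈ u.nodes) : Embeds (e₂ ∘ e₁) v t :=
  ⟨fun x hx => (h₂.label _ (hm x hx)).trans (h₁.label x hx),
    fun x y hxy => h₂.edge _ _ (h₁.edge x y hxy)⟩

theorem embeds_shift (t : TreeData L) (K : ℕ) : Embeds (· + K) t (t.shift K) :=
  ⟨fun x _ => by simp [shift], fun x y h => ⟨by simp, by simp, by simpa using h⟩⟩

theorem ConformsAt.shift {B : L} (h : u.ConformsAt D B) (K : ℕ) :
    (u.shift K).ConformsAt D B := by
  have ht := h.isTree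
  refine conformsAt_iff.2 ⟨⟨?_, ⟨by simp [TreeData.shift],
    by simpa [TreeData.shift] using ht.root_mem⟩,
    ?_, ?_, ?_, ?_⟩, ?_, ?_⟩
  · refine (ht.finite.image (· + K)).subset ?_
    rintro x ⟨hx, hx'⟩
    exact ⟨x - K, hx', Nat.sub_add_cancel hx⟩
  · rintro x y ⟨hx, hy, he⟩
    exact ⟨⟨hx, (ht.edge_mem _ _ he).1⟩, hy, (ht.edge_mem _ _ he).2⟩
  · rintro x ⟨-, -, he⟩
    exact ht.root_no_parent _ (by simpa [TreeData.shift] using he)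
  · rintro x x' y ⟨hx, -, he⟩ ⟨hx', -, he'⟩
    have := ht.parent_unique _ _ _ he he'
    omega
  · rintro x ⟨hx, hx'⟩
    have := (embeds_shift u K).reach (ht.reachable _ hx')
    rwa [show x - K + K = x from Nat.sub_add_cancel hx] at this
  · simpa [TreeData.shift] using h.root_label
  · rintro x ⟨hx, hx'⟩
    refine ⟨fun A hA => ?_, fun hs m hm => h.str_leaf _ hx' hs _ hm.2.2⟩
    obtain ⟨hAE, cs, hnd, hcs, hw⟩ := h.elem_node _ hx' A hA
    refine ⟨hAE, cs.map (· + K), hnd.map fun a b e => Nat.add_right_cancel e, fun m => ?_, ?_⟩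
    · rw [List.mem_map]
      constructor
      · rintro ⟨y, hy, rfl⟩
        exact ⟨hx, by simp, by simpa using (hcs y).1 hy⟩
      · rintro ⟨-, hm, he⟩
        exact ⟨m - K, (hcs _).2 he, Nat.sub_add_cancel hm⟩
    · rw [List.map_map]
      convert hw using 2
      ext y
      simp [TreeData.shift]

/-- A conforming tree has a copy whose nodes avoid a given finite set. -/
theorem ConformsAt.exists_copy {B : L} (h : u.ConformsAt D B) {F : Set ℕ} (hF : F.Finite) :
    ∃ (u' : TreeData L) (e : ℕ → ℕ), u'.ConformsAt D B ∧ Disjoint F u'.nodes ∧ Embeds e u u' ∧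
      e u.root = u'.root := by
  obtain ⟨K, hK⟩ := hF.bddAbove
  refine ⟨u.shift (K + 1), _, h.shift _, Set.disjoint_left.2 fun x hx hx' => ?_, embeds_shift u _,
    rfl⟩
  have := hK hx
  have := hx'.1
  omega

end TreeData

/-- A tree with root label `A` whose remaining nodes satisfy the conditions of conformity, and
whose root has children labeled by the word `w`, is obtained by attaching one copy of `g B` for
each letter `B` of `w` to a single node. -/
theorem exists_tree_of_word (A : L) (g : L → TreeData L) (w : List L)
    (hg : ∀ B ∈ w, (g B).ConformsAt D B) :
    ∃ t : TreeData L, t.IsTree ∧ t.label t.root = NodeLabel.elem A ∧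
      (∃ cs : List ℕ, cs.Nodup ∧ (∀ m, m ∈ cs ↔ t.edge t.root m) ∧
        cs.map t.label = w.map NodeLabel.elem) ∧
      (∀ x ∈ t.nodes, x ≠ t.root → LocallyConforms D t x) ∧
      ∀ B ∈ w, ∃ e, Embeds e (g B) t ∧ t.edge t.root (e (g B).root) := by
  induction w with
  | nil =>
    refine ⟨⟨{0}, fun _ _ => False, fun _ => NodeLabel.elem A, 0, fun _ => default⟩,
      ⟨Set.finite_singleton 0, rfl, fun _ _ h => h.elim, fun _ h => h, fun _ _ _ h => h.elim, ?_⟩,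
      rfl, ⟨[], List.nodup_nil, fun m => by simp, rfl⟩, fun x hx hx' => absurd hx hx', by simp⟩
    rintro x rfl
    exact ReflTransGen.refl
  | cons B w ih =>
    obtain ⟨t, ht, hl, ⟨cs, hnd, hcs, hw⟩, hok, hemb⟩ := ih fun B hB => hg B (by simp [hB])
    obtain ⟨u, e, hu, hd, he, her⟩ := (hg B (by simp)).exists_copy ht.finite
    have h := Step.of_insert (D := D) ht ht.root_mem hd hl hu
    have hd' : ∀ x, x ∈ t.nodes → x ∉ u.nodes := fun _ h => Set.disjoint_left.1 hd h
    have hur := hu.isTree.root_mem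
    have hcst : ∀ m ∈ cs, m ∈ t.nodes := fun m hm => (ht.edge_mem _ _ ((hcs m).1 hm)).2
    have hnod : ∀ {x}, x ∈ t.nodes → x ∈ (Update.apply t (Update.insert t.root u)).nodes :=
      fun hx => Or.inl hx
    refine ⟨Update.apply t (Update.insert t.root u), h.isTree', ?_,
      ⟨u.root :: cs, ?_, fun m => ?_, ?_⟩, fun x hx hxr => ?_, fun B' hB' => ?_⟩
    · exact (h.label_old _ ht.root_mem (hnod ht.root_mem)).trans hl
    · exact List.nodup_cons.2 ⟨fun hm => hd' _ (hcst _ hm) hur, hnd⟩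
    · rw [List.mem_cons, hcs]
      constructor
      · rintro (rfl | hm)
        · exact Or.inr (Or.inr ⟨rfl, rfl⟩)
        · exact Or.inl hm
      · rintro (hm | hm | ⟨-, rfl⟩)
        · exact Or.inr hm
        · exact absurd (hu.isTree.edge_mem _ _ hm).1 (hd' _ ht.root_mem)
        · exact Or.inl rfl
    · rw [List.map_cons, List.map_cons, ← hw]
      congr 1
      · exact (if_pos hur).trans hu.root_label
      · exact List.map_congr_left fun m hm => h.label_old m (hcst m hm) (hnod (hcst m hm))
    · by_cases hxt : x ∈ t.nodes
      · refine (hok x hxt hxr).congr (h.label_old x hxt hx) (fun m => ⟨fun hm => ?_, Or.inl⟩)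
          fun m hm => ?_
        · by_cases hmt : m ∈ t.nodes
          · exact (h.edge_old x m hmt (hnod hmt)).1 hm
          · exact absurd (h.new_child x m hm hxt hmt).1 hxr
        · have hmt := (ht.edge_mem _ _ hm).2
          exact h.label_old m hmt (hnod hmt)
      · exact h.new_ok x hx hxt
    · by_cases hB'w : B' ∈ w
      · obtain ⟨e', he', hr'⟩ := hemb B' hB'w
        refine ⟨e', ⟨fun x hx => ?_, fun x y hxy => Or.inl (he'.edge x y hxy)⟩, Or.inl hr'⟩
        have hm := he'.mem (hg B' hB').isTree ht (ht.edge_mem _ _ hr').2 hx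
        exact (h.label_old _ hm (hnod hm)).trans (he'.label x hx)
      · obtain rfl : B' = B := by simpa [hB'w] using hB'
        refine ⟨e, ⟨fun x hx => ?_, fun x y hxy => Or.inr (Or.inl (he.edge x y hxy))⟩,
          Or.inr (Or.inr ⟨rfl, her⟩)⟩
        have hm := he.mem (hg B' hB').isTree hu.isTree (her ▸ hur) hx
        exact (if_pos hm).trans (he.label x hx)

theorem exists_conformsAt_of_word {A : L} (hA : A ∈ D.Ele) (g : L → TreeData L) (w : List L)
    (hw : w.map NodeLabel.elem ∈ (D.Rg A).language) (hg : ∀ B ∈ w, (g B).ConformsAt D B) :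
    ∃ t : TreeData L, t.ConformsAt D A ∧
      ∀ B ∈ w, ∃ e, Embeds e (g B) t ∧ t.edge t.root (e (g B).root) := by
  obtain ⟨t, ht, hl, ⟨cs, hnd, hcs, hcw⟩, hok, hemb⟩ := exists_tree_of_word (D := D) A g w hg
  refine ⟨t, conformsAt_iff.2 ⟨ht, hl, fun x hx => ?_⟩, hemb⟩
  by_cases hxr : x = t.root
  · subst hxr
    refine ⟨fun B hB => ?_, fun hs => by cases hl.symm.trans hs⟩
    cases hl.symm.trans hB
    exact ⟨hA, cs, hnd, hcs, hcw ▸ hw⟩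
  · exact hok x hx hxr

theorem exists_conformsAt_of_str {A : L} (hA : A ∈ D.Ele) (hR : D.Rg A = ContentModel.str) :
    ∃ t : TreeData L, t.ConformsAt D A := by
  refine ⟨⟨{0, 1}, fun x y => x = 0 ∧ y = 1,
    fun x => Nat.casesOn x (NodeLabel.elem A) fun _ => NodeLabel.str, 0, fun _ => default⟩,
    ⟨⟨Set.toFinite _, Or.inl rfl, ?_, ?_, ?_, ?_⟩, rfl, ?_, ?_⟩⟩
  · rintro x y ⟨rfl, rfl⟩
    exact ⟨Or.inl rfl, Or.inr rfl⟩
  · rintro x ⟨-, h⟩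
    exact absurd h (by simp)
  · rintro x x' y ⟨rfl, -⟩ ⟨rfl, -⟩
    rfl
  · rintro x (rfl | rfl)
    · exact ReflTransGen.refl
    · exact ReflTransGen.single ⟨rfl, rfl⟩
  · rintro x (rfl | rfl) B hB
    · cases hB
      refine ⟨hA, [1], List.nodup_singleton 1, fun m => by simp, ?_⟩
      rw [hR]
      simp [ContentModel.language]
    · cases hB
  · rintro x (rfl | rfl) hx m ⟨h, -⟩
    · cases hx
    · cases h

theorem DTD.exists_word_of_sub {A B : L} (h : D.Sub A B) :
    ∃ w : List L, B ∈ w ∧ w.map NodeLabel.elem ∈ (D.Rg A).language ∧ ∀ C ∈ w, D.Sub A C := by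
  obtain ⟨hA, hB⟩ := h
  unfold DTD.Sub
  cases hR : D.Rg A with
  | str => rw [hR] at hB; cases hB
  | eps => rw [hR] at hB; cases hB
  | seq Bs =>
    rw [hR] at hB
    exact ⟨Bs, hB, rfl, fun C hC => ⟨hA, hC⟩⟩
  | alt Bs =>
    rw [hR] at hB
    refine ⟨[B], List.mem_singleton_self B, ⟨B, hB, rfl⟩, fun C hC => ?_⟩
    rw [List.mem_singleton.1 hC]
    exact ⟨hA, hB⟩
  | star B' =>
    rw [hR] at hB
    obtain rfl := List.mem_singleton.1 hB
    exact ⟨[B], List.mem_singleton_self B, ⟨1, rfl⟩, fun C hC => ⟨hA, hC⟩⟩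

/-- In a non-recursive DTD every element type has a conforming tree. -/
theorem exists_conformsAt (hD : D.NonRecursive) {A : L} (hA : A ∈ D.Ele) :
    ∃ t : TreeData L, t.ConformsAt D A := by
  have : IsStrictOrder L (fun B A => TransGen D.Sub A B) :=
    { irrefl := hD, trans := fun _ _ _ h h' => TransGen.trans h' h }
  refine (D.Ele.finite_toSet.wellFoundedOn (r := fun B A => TransGen D.Sub A B)).induction
    (P := fun A => ∃ t : TreeData L, t.ConformsAt D A) hA fun A hA ih => ?_
  have key : ∀ w : List L, w.map NodeLabel.elem ∈ (D.Rg A).language → (∀ C ∈ w, D.Sub A C) →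
      ∃ t : TreeData L, t.ConformsAt D A := by
    intro w hw hsub
    have : ∀ C, ∃ u : TreeData L, C ∈ w → u.ConformsAt D C := by
      intro C
      by_cases hC : C ∈ w
      · obtain ⟨u, hu⟩ := ih C (D.rg_mem A hA C (hsub C hC).2) (TransGen.single (hsub C hC))
        exact ⟨u, fun _ => hu⟩
      · exact ⟨⟨∅, fun _ _ => False, fun _ => NodeLabel.str, 0, fun _ => default⟩,
          fun h => absurd h hC⟩
    choose g hg using this
    obtain ⟨t, ht, -⟩ := exists_conformsAt_of_word hA g w hw hg
    exact ⟨t, ht⟩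
  cases hR : D.Rg A with
  | str => exact exists_conformsAt_of_str hA hR
  | eps => exact key [] (by rw [hR]; rfl) (by simp)
  | star B => exact key [] (by rw [hR]; exact ⟨0, rfl⟩) (by simp)
  | seq Bs =>
    refine key Bs (by rw [hR]; rfl) fun C hC => ⟨hA, ?_⟩
    rw [hR]
    exact hC
  | alt Bs =>
    cases Bs with
    | nil => exact absurd hR (D.rg_wellFormed A hA).2.2
    | cons B Bs =>
      obtain ⟨w, -, hw, hsub⟩ := exists_word_of_sub (sub_alt hA hR (List.mem_cons_self))
      exact key w hw hsub

/-- A tree conforming at `B` is the subtree below some child of the root of a tree conforming at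
`A`, if `B` is a subelement type of `A`. -/
theorem exists_conformsAt_of_sub (hD : D.NonRecursive) {A B : L} (h : D.Sub A B)
    (hv : v.ConformsAt D B) :
    ∃ (t : TreeData L) (e : ℕ → ℕ), t.ConformsAt D A ∧ Embeds e v t ∧ t.edge t.root (e v.root) := by
  obtain ⟨w, hBw, hw, hsub⟩ := exists_word_of_sub h
  have : ∀ C, ∃ u : TreeData L, (C ∈ w → u.ConformsAt D C) ∧ (C = B → u = v) := by
    intro C
    by_cases hC : C = B
    · exact ⟨v, fun _ => hC ▸ hv, fun _ => rfl⟩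
    · by_cases hCw : C ∈ w
      · obtain ⟨u, hu⟩ := exists_conformsAt hD (D.rg_mem A h.1 C (hsub C hCw).2)
        exact ⟨u, fun _ => hu, fun h => absurd h hC⟩
      · exact ⟨v, fun h => absurd h hCw, fun _ => rfl⟩
  choose g hg hgB using this
  obtain ⟨t, ht, hemb⟩ := exists_conformsAt_of_word h.1 g w hw hg
  obtain ⟨e, he, hr⟩ := hemb B hBw
  rw [hgB B rfl] at he hr
  exact ⟨t, e, ht, he, hr⟩

theorem exists_conformsAt_of_le (hD : D.NonRecursive) {A B : L} (h : D.Le A B)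
    (hv : v.ConformsAt D B) :
    ∃ (t : TreeData L) (e : ℕ → ℕ), t.ConformsAt D A ∧ Embeds e v t ∧ e v.root ∈ t.nodes := by
  induction h using ReflTransGen.head_induction_on with
  | refl => exact ⟨v, id, hv, Embeds.id v, hv.isTree.root_mem⟩
  | head hs _ ih =>
    obtain ⟨u, e₁, hu, he₁, hr₁⟩ := ih
    obtain ⟨t, e₂, ht, he₂, hr₂⟩ := exists_conformsAt_of_sub hD hs hu
    have hm : ∀ x ∈ v.nodes, e₁ x ∈ u.nodes := fun x hx => he₁.mem hv.isTree hu.isTree hr₁ hx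
    exact ⟨t, e₂ ∘ e₁, ht, he₂.comp he₁ hm,
      he₂.mem hu.isTree ht.isTree (ht.isTree.edge_mem _ _ hr₂).2 hr₁⟩

/-! ### Recreating a subtree -/

namespace TreeData

/-- The subtree of `t` at `n`. -/
def subtree (t : TreeData L) (n : ℕ) : TreeData L where
  nodes := t.desc n
  edge x y := x ∈ t.desc n ∧ t.edge x y
  label := t.label
  root := n
  val := t.val

theorem ConformsAt.subtree {R B : L} (ht : t.ConformsAt D R) {n : ℕ} (hn : n ∈ t.nodes)
    (hl : t.label n = NodeLabel.elem B) : (t.subtree n).ConformsAt D B := by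
  have hT := ht.isTree
  refine conformsAt_iff.2 ⟨⟨hT.finite.subset (hT.desc_subset hn), self_mem_desc t n,
    fun x y h => ⟨h.1, mem_desc_of_edge h.1 h.2⟩,
    fun x h => hT.acyclic (TransGen.tail' h.1 h.2),
    fun x x' y h h' => hT.parent_unique _ _ _ h.2 h'.2, fun x hx => ?_⟩, hl, fun x hx => ?_⟩
  · have hr : ReflTransGen t.edge n x := hx
    clear hx
    show ReflTransGen _ n x
    induction hr with
    | refl => exact ReflTransGen.refl
    | tail h he ih => exact ih.tail ⟨h, he⟩
  · exact ((conformsAt_iff.1 ht).2.2 x (hT.desc_subset hn hx)).congr rfl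
      (fun m => ⟨fun h => h.2, fun h => ⟨hx, h⟩⟩) fun _ _ => rfl

end TreeData

namespace Step

variable {A : L} {o : UATOp L} {c n : ℕ}

theorem mem_of_reach (h : Step D t t' A o c) (ht : t.IsTree) (hn : n ∈ t.nodes)
    (hnc : ReflTransGen t.edge n c) : n ∈ t'.nodes :=
  by_contra fun hn' => ht.acyclic (TransGen.trans_right hnc (h.old_desc n hn hn'))

theorem desc_iff (h : Step D t t' A o c) (ht : t.IsTree) {y : ℕ} (hy : y ∈ t.nodes)
    (hy' : y ∈ t'.nodes) : y ∈ t'.desc n ↔ y ∈ t.desc n := by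
  constructor
  · intro hd
    replace hd : ReflTransGen t'.edge n y := hd
    show ReflTransGen t.edge n y
    clear hy'
    induction hd with
    | refl => exact ReflTransGen.refl
    | tail _ he ih =>
      have he' := (h.edge_old _ _ hy (h.isTree'.edge_mem _ _ he).2).1 he
      exact (ih (ht.edge_mem _ _ he').1).tail he'
  · intro hd
    replace hd : ReflTransGen t.edge n y := hd
    show ReflTransGen t'.edge n y
    clear hy
    induction hd with
    | refl => exact ReflTransGen.refl
    | tail _ he ih =>
      have he' := (h.edge_old _ _ (ht.edge_mem _ _ he).2 hy').2 he
      exact (ih (h.isTree'.edge_mem _ _ he').1).tail he'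

theorem disjoint_desc (h : Step D t t' A o c) (ht : t.IsTree) (hn : n ∈ t.nodes)
    (hnc : ReflTransGen t.edge n c) : Disjoint (t.nodes \ t.desc n) (t'.subtree n).nodes :=
  Set.disjoint_left.2 fun _ hx hx' => hx.2 ((h.desc_iff ht hx.1
    (h.isTree'.desc_subset (h.mem_of_reach ht hn hnc) hx')).1 hx')

/-- An update that acts in the subtree at `n` amounts to the replacement of this subtree by the one
that results from it. -/
theorem same_replace (h : Step D t t' A o c) (ht : t.IsTree) {p : ℕ} (hp : t.edge p n)
    (hnc : ReflTransGen t.edge n c) :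
    Same (Update.apply t (Update.replace n (t'.subtree n))) t' := by
  have hn := (ht.edge_mem _ _ hp).2
  have hn' := h.mem_of_reach ht hn hnc
  have hsub := h.isTree'.desc_subset hn'
  have hc' : c ∈ t'.desc n := (h.desc_iff ht h.mem h.mem').2 hnc
  have hkeep : ∀ x ∈ t.nodes, x ∉ t.desc n → x ∈ t'.nodes := fun x hx hxn =>
    by_contra fun hx' => hxn (hnc.trans (h.old_desc x hx hx').to_reflTransGen)
  have hold : ∀ x ∈ t'.nodes, x ∉ t'.desc n → x ∈ t.nodes := fun x hx hxn =>
    by_contra fun hx' => hxn (ReflTransGen.trans hc' (h.new_desc x hx hx').to_reflTransGen)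
  refine ⟨?_, fun x y => ⟨?_, fun he => ?_⟩, h.root_eq.symm, fun x hx => ?_, fun x hx => ?_⟩
  · ext x
    constructor
    · rintro (hx | hx)
      · exact hkeep x hx.1 hx.2
      · exact hsub hx
    · intro hx
      by_cases hxn : x ∈ t'.desc n
      · exact Or.inr hxn
      · have hxt := hold x hx hxn
        exact Or.inl ⟨hxt, fun hd => hxn ((h.desc_iff ht hxt hx).2 hd)⟩
  · rintro (⟨he, hy⟩ | he | ⟨he, rfl⟩)
    · have hyt := (ht.edge_mem _ _ he).2
      exact (h.edge_old _ _ hyt (hkeep y hyt hy)).2 he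
    · exact he.2
    · exact (h.edge_old _ _ hn hn').2 he
  · obtain ⟨-, hy'⟩ := h.isTree'.edge_mem _ _ he
    by_cases hx : x ∈ t'.desc n
    · exact Or.inr (Or.inl ⟨hx, he⟩)
    by_cases hyn : y = n
    · subst hyn
      exact Or.inr (Or.inr ⟨(h.edge_old _ _ hn hn').1 he, rfl⟩)
    · have hyd : y ∉ t'.desc n := fun hd => hx (h.isTree'.parent_mem_desc hd hyn he)
      have hyt := hold y hy' hyd
      exact Or.inl ⟨(h.edge_old _ _ hyt hy').1 he, fun hd => hyd ((h.desc_iff ht hyt hy').2 hd)⟩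
  · by_cases hxu : x ∈ (t'.subtree n).nodes
    · exact if_pos hxu
    · have hx := hx.resolve_right hxu
      exact (if_neg hxu).trans (h.label_old x hx.1 (hkeep x hx.1 hx.2)).symm
  · by_cases hxu : x ∈ (t'.subtree n).nodes
    · exact if_pos hxu
    · have hx := hx.resolve_right hxu
      refine (if_neg hxu).trans ?_
      rcases h.val_old x hx.1 (hkeep x hx.1 hx.2) with e | ⟨-, he⟩
      · exact e.symm
      · exact absurd (mem_desc_of_edge (show c ∈ t.desc n from hnc) he) hx.2

end Step

/-! ### Sequences of replacements -/

/-- Replacing the subtree at `n` by `u`, and `u` by `u'`, amounts to replacing the former by `u'`.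
-/
theorem same_replace_replace (ht : t.IsTree) (hu : u.IsTree) {n : ℕ}
    (hd : Disjoint t.nodes u.nodes) (u' : TreeData L) :
    Same (Update.apply (Update.apply t (Update.replace n u)) (Update.replace u.root u'))
      (Update.apply t (Update.replace n u')) := by
  have hd' : ∀ x, x ∈ t.nodes → x ∉ u.nodes := fun _ h => Set.disjoint_left.1 hd h
  have hdesc : ∀ y, y ∈ (Update.apply t (Update.replace n u)).desc u.root ↔ y ∈ u.nodes := by
    intro y
    constructor
    · intro h
      replace h : ReflTransGen (Update.apply t (Update.replace n u)).edge u.root y := h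
      induction h with
      | refl => exact hu.root_mem
      | tail _ he ih =>
        rcases he with he | he | ⟨he, -⟩
        · exact absurd ih (hd' _ (ht.edge_mem _ _ he.1).1)
        · exact (hu.edge_mem _ _ he).2
        · exact absurd ih (hd' _ (ht.edge_mem _ _ he).1)
    · intro h
      exact reflTransGen_imp (fun _ _ h => Or.inr (Or.inl h)) (hu.reachable y h)
  have hnodes : ∀ x, x ∈ (Update.apply t (Update.replace n u)).nodes \
      (Update.apply t (Update.replace n u)).desc u.root ↔ x ∈ t.nodes \ t.desc n := by
    intro x
    constructor
    · rintro ⟨hx | hx, hx'⟩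
      · exact hx
      · exact absurd ((hdesc x).2 hx) hx'
    · exact fun hx => ⟨Or.inl hx, fun hx' => hd' _ hx.1 ((hdesc x).1 hx')⟩
  refine ⟨?_, fun x y => ⟨?_, ?_⟩, rfl, fun x hx => ?_, fun x hx => ?_⟩
  · ext x
    exact or_congr (hnodes x) Iff.rfl
  · rintro (⟨he, hy⟩ | he | ⟨he, rfl⟩)
    · rw [hdesc] at hy
      rcases he with he | he | ⟨-, rfl⟩
      · exact Or.inl he
      · exact absurd (hu.edge_mem _ _ he).2 hy
      · exact absurd hu.root_mem hy
    · exact Or.inr (Or.inl he)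
    · rcases he with he | he | ⟨he, -⟩
      · exact absurd hu.root_mem (hd' _ (ht.edge_mem _ _ he.1).2)
      · exact absurd he (hu.root_no_parent _)
      · exact Or.inr (Or.inr ⟨he, rfl⟩)
  · rintro (⟨he, hy⟩ | he | ⟨he, rfl⟩)
    · exact Or.inl ⟨Or.inl ⟨he, hy⟩, fun h => hd' _ (ht.edge_mem _ _ he).2 ((hdesc y).1 h)⟩
    · exact Or.inr (Or.inl he)
    · exact Or.inr (Or.inr ⟨Or.inr (Or.inr ⟨he, rfl⟩), rfl⟩)
  · by_cases hxu : x ∈ u'.nodes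
    · exact (if_pos hxu).trans (if_pos hxu).symm
    · have hx := (hnodes x).1 (hx.resolve_right hxu)
      exact (if_neg hxu).trans ((if_neg (hd' _ hx.1)).trans (if_neg hxu).symm)
  · by_cases hxu : x ∈ u'.nodes
    · exact (if_pos hxu).trans (if_pos hxu).symm
    · have hx := (hnodes x).1 (hx.resolve_right hxu)
      exact (if_neg hxu).trans ((if_neg (hd' _ hx.1)).trans (if_neg hxu).symm)

section

variable {S : Set (UAT L)} {A B X : L}

/-- The first replacement of a sequence of replacements at the child `n` of `p`. Here `u'` may reuse
nodes of the subtree at `n`. -/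
theorem allowedSeq_replace_cons (hD : D.NonRecursive) (hS : S ⊆ D.valid) {Y : L}
    (hBY : ReplaceEdge S A B Y) {p n : ℕ} (ht : t.IsTree) (hn : t.label n = NodeLabel.elem B)
    (hp : t.edge p n) (hl : t.label p = NodeLabel.elem A) {u' : TreeData L} (hu' : u'.IsTree)
    (hd : Disjoint (t.nodes \ t.desc n) u'.nodes)
    (ih : ∀ (t : TreeData L) (n : ℕ), t.IsTree → t.label n = NodeLabel.elem Y → t.edge p n →
      t.label p = NodeLabel.elem A → Disjoint t.nodes u'.nodes →
      ∃ ops, AllowedSeq D S t ops ∧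
        Same (Update.applySeq t ops) (Update.apply t (Update.replace n u'))) :
    ∃ ops, AllowedSeq D S t ops ∧
      Same (Update.applySeq t ops) (Update.apply t (Update.replace n u')) := by
  obtain ⟨Bs, hR, hA, hB, hY, hne⟩ := rg_of_replace_mem_valid (hS hBY)
  obtain ⟨w, hw⟩ := exists_conformsAt hD (D.rg_mem A hA Y (sub_alt hA hR hY).2)
  obtain ⟨u, _, hu, hdu, -, -⟩ := hw.exists_copy (ht.finite.union hu'.finite)
  obtain ⟨hdt, hdu'⟩ := Set.disjoint_union_left.1 hdu
  have hpn := ht.edge_mem _ _ hp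
  have hur := hu.isTree.root_mem
  obtain ⟨ops, hops, hsame⟩ := ih (Update.apply t (Update.replace n u)) u.root
    (ht.replace hu.isTree hp (hdt.mono_left Set.sdiff_subset))
    ((if_pos hur).trans hu.root_label) (Or.inr (Or.inr ⟨hp, rfl⟩))
    ((if_neg (Set.disjoint_left.1 hdt hpn.1)).trans hl)
    (Set.disjoint_union_left.2 ⟨hd, hdu'.symm⟩)
  exact ⟨Update.replace n u :: ops,
    ⟨⟨hpn.2, hdt⟩, ⟨_, hBY, Matches.replace hn hu hp hl hne⟩, hops⟩,
    hsame.trans (same_replace_replace ht hu.isTree hdt u')⟩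

/-- Replacements along a path of `𝒢_A(S)` from `B` to `X` turn the subtree at a node labeled `B`
into an arbitrary tree conforming at `X`. -/
theorem exists_allowedSeq_of_replaceEdgePlus (hD : D.NonRecursive) (hS : S ⊆ D.valid)
    (h : ReplaceEdgePlus S A B X) {u' : TreeData L} (hu' : u'.ConformsAt D X) {p : ℕ} :
    ∀ (t : TreeData L) (n : ℕ), t.IsTree → t.label n = NodeLabel.elem B → t.edge p n →
      t.label p = NodeLabel.elem A → Disjoint t.nodes u'.nodes →
      ∃ ops, AllowedSeq D S t ops ∧
        Same (Update.applySeq t ops) (Update.apply t (Update.replace n u')) := by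
  induction h using TransGen.head_induction_on with
  | single h =>
    intro t n ht hn hp hl hd
    obtain ⟨-, -, -, -, -, hne⟩ := rg_of_replace_mem_valid (hS h)
    exact ⟨[Update.replace n u'], ⟨⟨(ht.edge_mem _ _ hp).2, hd⟩,
      ⟨_, h, Matches.replace hn hu' hp hl hne⟩, trivial⟩, Same.refl _⟩
  | head h _ ih =>
    intro t n ht hn hp hl hd
    exact allowedSeq_replace_cons hD hS h ht hn hp hl hu'.isTree (hd.mono_left Set.sdiff_subset) ih

/-- If children labeled `B` can be both deleted and inserted below `A`, the subtree at such a child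
can be exchanged. -/
theorem exists_allowedSeq_of_star (hi : (A, UATOp.insert B) ∈ S) (hd : (A, UATOp.delete B) ∈ S)
    {p n : ℕ} (ht : t.IsTree) (hn : t.label n = NodeLabel.elem B) (hp : t.edge p n)
    (hl : t.label p = NodeLabel.elem A) {u' : TreeData L} (hu' : u'.ConformsAt D B)
    (hdisj : Disjoint (t.nodes \ t.desc n) u'.nodes) :
    ∃ ops, AllowedSeq D S t ops ∧
      Same (Update.applySeq t ops) (Update.apply t (Update.replace n u')) := by
  refine ⟨[Update.delete n, Update.insert p u'], ⟨(ht.edge_mem _ _ hp).2,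
    ⟨_, hd, Matches.delete hn hp hl⟩,
    ⟨⟨(ht.edge_mem _ _ hp).1, ht.parent_notMem_desc hp⟩, hdisj⟩,
    ⟨_, hi, Matches.insert hl hu'⟩, trivial⟩, ?_⟩
  rw [← ht.insert_delete hp]
  exact Same.refl _

/-- If `B` lies on a cycle of `𝒢_A(S)`, the subtree at a child labeled `B` of a node labeled `A`
can be exchanged. -/
theorem exists_allowedSeq_of_cycle (hD : D.NonRecursive) (hS : S ⊆ D.valid)
    (h : ReplaceEdgePlus S A B B) {p n : ℕ} (ht : t.IsTree) (hn : t.label n = NodeLabel.elem B)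
    (hp : t.edge p n) (hl : t.label p = NodeLabel.elem A) {u' : TreeData L}
    (hu' : u'.ConformsAt D B) (hd : Disjoint (t.nodes \ t.desc n) u'.nodes) :
    ∃ ops, AllowedSeq D S t ops ∧
      Same (Update.applySeq t ops) (Update.apply t (Update.replace n u')) := by
  obtain ⟨Y, hBY, hYB⟩ := TransGen.head'_iff.1 h
  rcases reflTransGen_iff_eq_or_transGen.1 hYB with rfl | hYB
  · obtain ⟨-, -, -, -, -, hne⟩ := rg_of_replace_mem_valid (hS hBY)
    exact absurd rfl hne
  · exact allowedSeq_replace_cons hD hS hBY ht hn hp hl hu'.isTree hd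
      (exists_allowedSeq_of_replaceEdgePlus hD hS hYB hu')

end

/-! ### Updates in `T(S)` can be simulated by updates in `S` -/

/-- An update of a given valid type `(C, o)` can be carried out in a tree that contains a suitable
tree conforming at `C`. -/
theorem exists_update (hD : D.NonRecursive) {C : L} {o : UATOp L} (huv : (C, o) ∈ D.valid) :
    ∃ v : TreeData L, v.ConformsAt D C ∧ ∀ (t : TreeData L) (e : ℕ → ℕ) (R : L),
      t.ConformsAt D R → Embeds e v t → e v.root ∈ t.nodes →
      ∃ op : Update L, op.Valid t ∧ Matches D t op (C, o) ∧ Update.apply t op ≠ t ∧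
        Step D t (Update.apply t op) C o (e v.root) := by
  -- the label of `e v.root` is that of the root of `v`
  have hroot : ∀ {v t : TreeData L} {e : ℕ → ℕ}, v.ConformsAt D C → Embeds e v t →
      t.label (e v.root) = NodeLabel.elem C := fun hv he =>
    (he.label _ hv.isTree.root_mem).trans hv.root_label
  cases huv with
  | @insert _ B hC hR =>
    obtain ⟨v, hv⟩ := exists_conformsAt hD hC
    obtain ⟨w, hw⟩ := exists_conformsAt hD (D.rg_mem C hC B (sub_star hC hR).2)
    refine ⟨v, hv, fun t e R ht he hr => ?_⟩
    obtain ⟨u, -, hu, hd, -, -⟩ := hw.exists_copy ht.isTree.finite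
    refine ⟨Update.insert (e v.root) u, ⟨hr, hd⟩, Matches.insert (hroot hv he) hu, fun h => ?_,
      Step.of_insert ht.isTree hr hd (hroot hv he) hu⟩
    have hm : u.root ∈ (Update.apply t (Update.insert (e v.root) u)).nodes :=
      Or.inr hu.isTree.root_mem
    rw [h] at hm
    exact Set.disjoint_left.1 hd hm hu.isTree.root_mem
  | @delete _ B hC hR =>
    obtain ⟨w, hw⟩ := exists_conformsAt hD (D.rg_mem C hC B (sub_star hC hR).2)
    obtain ⟨v, e₁, hv, he₁, hr₁⟩ := exists_conformsAt_of_sub hD (sub_star hC hR) hw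
    refine ⟨v, hv, fun t e R ht he hr => ?_⟩
    have hedge := he.edge _ _ hr₁
    have hm := (ht.isTree.edge_mem _ _ hedge).2
    have hl := ht.star_child hr (hroot hv he) hR hedge
    refine ⟨Update.delete (e (e₁ w.root)), hm, Matches.delete hl hedge (hroot hv he), fun h => ?_,
      Step.of_delete ht.isTree hl hedge (hroot hv he)⟩
    rw [← h] at hm
    exact hm.2 (self_mem_desc t _)
  | @replace _ B B' Bs hC hR hB hB' hne =>
    obtain ⟨w, hw⟩ := exists_conformsAt hD (D.rg_mem C hC B (sub_alt hC hR hB).2)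
    obtain ⟨w', hw'⟩ := exists_conformsAt hD (D.rg_mem C hC B' (sub_alt hC hR hB').2)
    obtain ⟨v, e₁, hv, he₁, hr₁⟩ := exists_conformsAt_of_sub hD (sub_alt hC hR hB) hw
    refine ⟨v, hv, fun t e R ht he hr => ?_⟩
    obtain ⟨u, -, hu, hd, -, -⟩ := hw'.exists_copy ht.isTree.finite
    have hedge := he.edge _ _ hr₁
    have hm := (ht.isTree.edge_mem _ _ hedge).2
    have hl : t.label (e (e₁ w.root)) = NodeLabel.elem B :=
      (he.label _ (hv.isTree.edge_mem _ _ hr₁).2).trans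
        ((he₁.label _ hw.isTree.root_mem).trans hw.root_label)
    refine ⟨Update.replace (e (e₁ w.root)) u, ⟨hm, hd⟩,
      Matches.replace hl hu hedge (hroot hv he) hne, fun h => ?_,
      Step.of_replace ht.isTree hd hl hu hedge (hroot hv he) hne⟩
    have hm : u.root ∈ (Update.apply t (Update.replace (e (e₁ w.root)) u)).nodes :=
      Or.inr hu.isTree.root_mem
    rw [h] at hm
    exact Set.disjoint_left.1 hd hm hu.isTree.root_mem
  | replaceText hC hR =>
    obtain ⟨v, hv⟩ := exists_conformsAt hD hC
    refine ⟨v, hv, fun t e R ht he hr => ?_⟩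
    obtain ⟨m, hedge, hl⟩ : ∃ m, t.edge (e v.root) m ∧ t.label m = NodeLabel.str := by
      obtain ⟨-, cs, -, hcs, hw⟩ := ht.elem_node _ hr C (hroot hv he)
      rw [hR] at hw
      have hm : NodeLabel.str ∈ cs.map t.label := by
        rw [show cs.map t.label = [NodeLabel.str] from hw]
        exact List.mem_singleton_self _
      obtain ⟨m, hm, hl⟩ := List.mem_map.1 hm
      exact ⟨m, (hcs m).1 hm, hl⟩
    obtain ⟨s, hs⟩ : ∃ s : String, s ≠ t.val m := by
      refine ⟨(t.val m).push default, fun h => ?_⟩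
      have := congrArg String.length h
      simp at this
    refine ⟨Update.replaceText m s, (ht.isTree.edge_mem _ _ hedge).2,
      Matches.replaceText hl hedge (hroot hv he), fun h => hs ?_,
      Step.of_replaceText ht.isTree hl hedge (hroot hv he)⟩
    have hval : Function.update t.val m s m = t.val m := congrFun (congrArg TreeData.val h) m
    rwa [Function.update_self] at hval

/-- If the allowed updates at `A` permit to exchange the subtree at a child labeled `B`, every
update type below `B` has an effective update that can be simulated. -/
theorem exists_simulation_of_exchange (hD : D.NonRecursive) (hreach : D.AllReachable)
    {S : Set (UAT L)} {A B C : L} {o : UATOp L} (hAB : D.Sub A B) (hBC : D.Le B C)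
    (huv : (C, o) ∈ D.valid)
    (hex : ∀ (t u' : TreeData L) (p n : ℕ), t.IsTree → t.label n = NodeLabel.elem B → t.edge p n →
      t.label p = NodeLabel.elem A → u'.ConformsAt D B →
      Disjoint (t.nodes \ t.desc n) u'.nodes →
      ∃ ops, AllowedSeq D S t ops ∧
        Same (Update.applySeq t ops) (Update.apply t (Update.replace n u'))) :
    ∃ (t : TreeData L) (op : Update L) (ops : List (Update L)), t.Conforms D ∧ op.Valid t ∧
      Matches D t op (C, o) ∧ Update.apply t op ≠ t ∧ AllowedSeq D S t ops ∧
      (Update.applySeq t ops).Iso (Update.apply t op) := by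
  obtain ⟨v, hv, hvop⟩ := exists_update hD huv
  obtain ⟨vB, e₁, hvB, he₁, hr₁⟩ := exists_conformsAt_of_le hD hBC hv
  obtain ⟨vA, e₂, hvA, he₂, hr₂⟩ := exists_conformsAt_of_sub hD hAB hvB
  obtain ⟨t, e₃, ht, he₃, hr₃⟩ := exists_conformsAt_of_le hD (hreach A hAB.1) hvA
  have hm₁ : ∀ x ∈ v.nodes, e₁ x ∈ vB.nodes := fun x => he₁.mem hv.isTree hvB.isTree hr₁
  have hm₂ : ∀ x ∈ vB.nodes, e₂ x ∈ vA.nodes := fun x =>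
    he₂.mem hvB.isTree hvA.isTree (hvA.isTree.edge_mem _ _ hr₂).2
  have hm₃ : ∀ x ∈ vA.nodes, e₃ x ∈ t.nodes := fun x => he₃.mem hvA.isTree ht.isTree hr₃
  have hB := he₃.comp he₂ hm₂
  have hC := hB.comp he₁ hm₁
  have hp : t.edge (e₃ vA.root) (e₃ (e₂ vB.root)) := he₃.edge _ _ hr₂
  have hpl : t.label (e₃ vA.root) = NodeLabel.elem A :=
    (he₃.label _ hvA.isTree.root_mem).trans hvA.root_label
  have hnl : t.label (e₃ (e₂ vB.root)) = NodeLabel.elem B :=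
    (hB.label _ hvB.isTree.root_mem).trans hvB.root_label
  have hnc : ReflTransGen t.edge (e₃ (e₂ vB.root)) (e₃ (e₂ (e₁ v.root))) :=
    hB.reach (hvB.isTree.reachable _ hr₁)
  obtain ⟨op, hval, hmat, hne, hstep⟩ := hvop t _ D.rt ht hC (hm₃ _ (hm₂ _ hr₁))
  have hn := (ht.isTree.edge_mem _ _ hp).2
  have hn' := hstep.mem_of_reach ht.isTree hn hnc
  obtain ⟨ops, hops, hsame⟩ := hex t _ _ _ ht.isTree hnl hp hpl
    ((hstep.conformsAt ht huv).subtree hn' ((hstep.label_old _ hn hn').trans hnl))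
    (hstep.disjoint_desc ht.isTree hn hnc)
  exact ⟨t, op, ops, ht, hval, hmat, hne, hops,
    (hsame.trans (hstep.same_replace ht.isTree hp hnc)).iso⟩

/-- For every member of `T(S)` outside `S`, some update of this type that has an effect can be
simulated by updates in `S`. -/
theorem exists_simulation (hD : D.NonRecursive) (hreach : D.AllReachable) {S : Set (UAT L)}
    (hS : S ⊆ D.valid) {uat : UAT L} (hT : uat ∈ D.T S) (huS : uat ∉ S) :
    ∃ (t : TreeData L) (op : Update L) (ops : List (Update L)), t.Conforms D ∧ op.Valid t ∧
      Matches D t op uat ∧ Update.apply t op ≠ t ∧ AllowedSeq D S t ops ∧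
      (Update.applySeq t ops).Iso (Update.apply t op) := by
  obtain ⟨C, o⟩ := uat
  rcases hT with ((h | ⟨hv, A, hA, B, hR, hi, hd, hle⟩) | ⟨hv, A, hA, Bs, hR, B, hB, hp, hle⟩) |
    ⟨hv, A, hA, Bs, hR, B, hB, B', hB', hp, e⟩
  · exact absurd h huS
  · exact exists_simulation_of_exchange hD hreach (sub_star hA hR) hle hv
      fun _ _ _ _ ht hn hpn hl hu' hdis => exists_allowedSeq_of_star hi hd ht hn hpn hl hu' hdis
  · exact exists_simulation_of_exchange hD hreach (sub_alt hA hR hB) hle hv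
      fun _ _ _ _ ht hn hpn hl hu' hdis => exists_allowedSeq_of_cycle hD hS hp ht hn hpn hl hu' hdis
  · cases e
    obtain ⟨v, hv', hvop⟩ := exists_update hD hv
    obtain ⟨t, e, ht, he, hr⟩ := exists_conformsAt_of_le hD (hreach C hA) hv'
    obtain ⟨op, hval, hmat, hne, -⟩ := hvop t e D.rt ht he hr
    cases hmat with
    | replace hn hu hpn hl hne' =>
      obtain ⟨ops, hops, hsame⟩ := exists_allowedSeq_of_replaceEdgePlus hD hS hp hu t _ ht.isTree hn
        hpn hl hval.2
      exact ⟨t, _, ops, ht, hval, Matches.replace hn hu hpn hl hne', hne, hops, hsame.iso⟩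

theorem AllowedSeq.mono {S S' : Set (UAT L)} (h : S ⊆ S') {t : TreeData L}
    {ops : List (Update L)} (hops : AllowedSeq D S t ops) : AllowedSeq D S' t ops := by
  induction ops generalizing t with
  | nil => trivial
  | cons op ops ih =>
    obtain ⟨hv, ⟨uat, hu, hm⟩, hrest⟩ := hops
    exact ⟨hv, ⟨uat, h hu, hm⟩, ih hrest⟩

/-! ### Consistency of policies -/

namespace Policy

variable {P Q : Policy D}

theorem Consistent.of_extendedBy (h : P.ExtendedBy Q) (hQ : Q.Consistent) : P.Consistent := by
  rintro t ht ⟨ops, op, hops, hv, ⟨uat, hu, hm⟩, hne, hiso⟩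
  exact hQ t ht ⟨ops, op, hops.mono h.1, hv, ⟨uat, h.2 hu, hm⟩, hne, hiso⟩

theorem Consistent.T_inter_eq_empty (hD : D.NonRecursive) (hreach : D.AllReachable)
    (hP : P.Consistent) : D.T P.allowed ∩ P.forbidden = ∅ := by
  refine Set.eq_empty_of_forall_notMem fun uat ⟨hT, hF⟩ => ?_
  obtain ⟨t, op, ops, ht, hv, hm, hne, hops, hiso⟩ := exists_simulation hD hreach P.allowed_valid hT
    fun hA => Set.disjoint_left.1 P.disjoint hA hF
  exact hP t ht ⟨ops, op, hops, hv, ⟨uat, hF, hm⟩,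
    hm.not_iso ht hv (P.forbidden_valid hF) hne, hiso⟩

/-- The policy `(T(𝒜), valid(D) ∖ T(𝒜))`. -/
def closure (P : Policy D) : Policy D where
  allowed := D.T P.allowed
  forbidden := D.valid \ D.T P.allowed
  allowed_valid := T_subset_valid P.allowed_valid
  forbidden_valid := Set.sdiff_subset
  disjoint := Set.disjoint_sdiff_right

theorem closure_isTotal (P : Policy D) : P.closure.IsTotal :=
  Set.union_sdiff_cancel (T_subset_valid P.allowed_valid)

theorem extendedBy_closure (h : D.T P.allowed ∩ P.forbidden = ∅) : P.ExtendedBy P.closure :=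
  ⟨subset_T D _, fun uat hF => ⟨P.forbidden_valid hF, fun hT =>
    (Set.eq_empty_iff_forall_notMem.1 h uat) ⟨hT, hF⟩⟩⟩

theorem closure_consistent (P : Policy D) : P.closure.Consistent := by
  rintro t ht ⟨ops, op, hops, hv, ⟨uat, ⟨huv, huT⟩, hm⟩, hne, hiso⟩
  exact not_iso_of_allowedSeq P.allowed_valid ht hops hv hm huv huT
    (fun h => hne (by rw [h]; exact Iso.refl t)) hiso

end Policy

end XMLPolicy

theorem mainTheorem2 {L : Type*} (D : XMLPolicy.DTD L) (hD : D.NonRecursive)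
    (hreach : D.AllReachable) (P : XMLPolicy.Policy D) :
    List.TFAE [P.Quasiconsistent, P.Consistent, D.T P.allowed ∩ P.forbidden = ∅] ∧
    (P.Consistent →
      ∃ Q : XMLPolicy.Policy D,
        Q.allowed = D.T P.allowed ∧ Q.forbidden = D.valid \ D.T P.allowed ∧
        P.ExtendedBy Q ∧ Q.IsTotal ∧ Q.Consistent) := by
  refine ⟨?_, fun h => ⟨P.closure, rfl, rfl,
    XMLPolicy.Policy.extendedBy_closure (h.T_inter_eq_empty hD hreach), P.closure_isTotal,
    P.closure_consistent⟩⟩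
  tfae_have 1 → 2 := fun ⟨Q, hQ, _, hc⟩ => XMLPolicy.Policy.Consistent.of_extendedBy hQ hc
  tfae_have 2 → 3 := fun h => h.T_inter_eq_empty hD hreach
  tfae_have 3 → 1 := fun h => ⟨P.closure, XMLPolicy.Policy.extendedBy_closure h, P.closure_isTotal,
    P.closure_consistent⟩
  tfae_finish
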